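/- Let $n$ be a positive integer and let $q$, $a$, $A$, $b$, $x_1,\dots,x_n$ be complex numbers with $0<|q|<1$. For multi-indices $\mathbf k=(k_1,\dots,k_n)$ of non-negative integers write $|\mathbf k|=k_1+\cdots+k_n$, and let $\beta(\mathbf j)$ be any complex numbers indexed by such multi-indices. Write $(u)_m=\prod_{i=0}^{m-1}(1-uq^i)$, $(u)_\infty=\prod_{i\ge 0}(1-uq^i)$, $(u,v)_m=(u)_m(v)_m$, and $$V(\mathbf k)=\prod_{1\le r<s\le n}\frac{1-q^{k_r-k_s}x_r/x_s}{1-x_r/x_s}.$$ Products of the form $\prod_{r,s=1}^n\big(\tfrac{x_r}{x_sy_s}\big)_{k_r}\,(y_1\cdots y_n)^{|\mathbf k|}$ are polynomials in $\mathbf y=(y_1,\dots,y_n)$, namely $\prod_{r,s=1}^n\prod_{i=0}^{k_r-1}(y_s-q^ix_r/x_s)$, and are understood in this way also when some $y_s=0$. Consider the identity $$\begin{aligned} &\frac{(A,\,aAy_1\cdots y_n/b)_\infty}{(aA/b,\,Ay_1\cdots y_n)_\infty}\prod_{r=1}^n\frac{(bqx_ry_r,\,aqx_r)_\infty}{(aqx_ry_r,\,bqx_r)_\infty}\\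 &\quad\times\sum_{j_1,\dots,j_n\ge0}V(\mathbf j)\prod_{r,s=1}^n\Big(\frac{x_r}{x_sy_s}\Big)_{j_r}\prod_{r=1}^n\frac{1-bx_rq^{j_r+|\mathbf j|}}{(1-bx_r)(bqx_ry_r)_{|\mathbf j|}}\,(y_1\cdots y_n)^{|\mathbf j|}q^{\sum_r(r-1)j_r}\beta(\mathbf j)\\ =&\sum_{k_1,\dots,k_n\ge0}V(\mathbf k)\prod_{r,s=1}^n\frac{(x_r/x_sy_s)_{k_r}}{(qx_r/x_s)_{k_r}}\prod_{r=1}^n\frac{1-ax_rq^{k_r+|\mathbf k|}}{1-ax_r}\prod_{r=1}^n\frac{(ax_r)_{|\mathbf k|}(bqx_r/A)_{k_r}}{(aqx_ry_r)_{|\mathbf k|}(bqx_r)_{k_r}}\\ &\quad\times\frac{(a/b)_{|\mathbf k|}}{(aA/b)_{|\mathbf k|}}(Ay_1\cdots y_n)^{|\mathbf k|}q^{\sum_r(r-1)k_r}\\ &\quad\times\sum_{\substack{0\le j_r\le k_r\\ r=1,\dots,n}}V(\mathbf j)\prod_{r,s=1}^n\Big(q^{-k_s}\frac{x_r}{x_s}\Big)_{j_r}\prod_{r=1}^n\frac{(1-bx_rq^{j_r+|\mathbf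 j|})(ax_rq^{|\mathbf k|})_{j_r}}{(1-bx_r)(bqx_r/A)_{j_r}(bx_rq^{k_r+1})_{|\mathbf j|}}\\ &\qquad\qquad\times\frac{(A)_{|\mathbf j|}}{(bq^{1-|\mathbf k|}/a)_{|\mathbf j|}}\,q^{\sum_r(r-1)j_r}\Big(\frac{bq}{aA}\Big)^{|\mathbf j|}\beta(\mathbf j). \end{aligned}\tag{$*$}$$ (i) Let $\rho_1,\dots,\rho_n>0$, and suppose that for every $\mathbf y$ in the polydisc $D=\{\mathbf y\in\mathbb C^n:|y_r|<\rho_r,\ r=1,\dots,n\}$ no denominator in $(*)$ vanishes, that for every $\mathbf y\in D$ the series over $\mathbf j$ on the left-hand side and the series over $\mathbf k$ on the right-hand side (whose terms contain the finite inner sum) converge absolutely, and that the sums of both series are analytic functions of $\mathbf y$ on $D$. Then $(*)$ holds for all $\mathbf y\in D$. (ii) Let $N_1,\dots,N_n$ be non-negative integers and $y_r=q^{N_r}$ for $r=1,\dots,n$, and suppose that no denominator in $(*)$ vanishes for summation indices with $j_r,k_r\le N_r$ for all $r$. Then both series terminate: the terms of the left-hand series vanish unless $j_r\le N_r$ for all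 $r$, and the terms of the right-hand series vanish unless $k_r\le N_r$ for all $r$. Moreover $(*)$ holds. -/

import Mathlib

noncomputable section

namespace AnSeries

/-- The `q`-rising factorial `(u; q)_m = (1 - u)(1 - uq) ⋯ (1 - uq^{m-1})`. -/
def qPoch (q u : ℂ) (m : ℕ) : ℂ :=
  ∏ i ∈ Finset.range m, (1 - u * q ^ i)

/-- The infinite `q`-rising factorial `(u; q)_∞`, for `|q| < 1`. -/
def qPochInf (q u : ℂ) : ℂ :=
  ∏' i : ℕ, (1 - u * q ^ i)

/-- For `|q| < 1` the infinite product defining `(u; q)_∞` converges. -/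
theorem multipliable_qPochInf {q : ℂ} (hq : ‖q‖ < 1) (u : ℂ) :
    Multipliable (fun i : ℕ => 1 - u * q ^ i) := by
  have h : Summable (fun i : ℕ => ‖-(u * q ^ i)‖) := by
    simp only [norm_neg, norm_mul, norm_pow]
    exact (summable_geometric_of_lt_one (norm_nonneg q) hq).mul_left ‖u‖
  simpa [sub_eq_add_neg] using multipliable_one_add_of_summable h

/-- The polynomial `v^m (u/v; q)_m = (v - u)(v - uq) ⋯ (v - uq^{m-1})` in `v`, which makes sense
at `v = 0` as well. -/
def qPochHom (q u v : ℂ) (m : ℕ) : ℂ :=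
  ∏ i ∈ Finset.range m, (v - u * q ^ i)

theorem qPochHom_eq (q u : ℂ) {v : ℂ} (hv : v ≠ 0) (m : ℕ) :
    qPochHom q u v m = v ^ m * qPoch q (u / v) m := by
  have h : ∀ i ∈ Finset.range m, v - u * q ^ i = v * (1 - u / v * q ^ i) := by
    intro i _
    field_simp
  rw [qPochHom, qPoch, Finset.prod_congr rfl h, Finset.prod_mul_distrib, Finset.prod_const,
    Finset.card_range]

variable {n : ℕ}

/-- `|k| = k_1 + ⋯ + k_n`. -/
def size (k : Fin n → ℕ) : ℕ := ∑ r, k r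

/-- The Vandermonde factor of type `A`:
`∏_{r < s} (1 - q^{k_r - k_s} x_r / x_s) / (1 - x_r / x_s)`. -/
def vandermonde (q : ℂ) (x : Fin n → ℂ) (k : Fin n → ℕ) : ℂ :=
  ∏ r, ∏ s ∈ Finset.Ioi r,
    (1 - q ^ ((k r : ℤ) - (k s : ℤ)) * (x r / x s)) / (1 - x r / x s)

/-- `q^{∑_r (r - 1) k_r}`, where `r` runs over `1, …, n`; in Lean the index `r : Fin n` runs
over `0, …, n - 1` and so stands for `r - 1`. -/
def powerq (q : ℂ) (k : Fin n → ℕ) : ℂ :=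
  q ^ (∑ r : Fin n, (r : ℕ) * k r)

/-- The factor `∏_{r, s} (x_r / (x_s y_s); q)_{k_r} · (y_1 ⋯ y_n)^{|k|}`, written as a polynomial
in `y`, so that it has its correct value also where some `y_s` is `0`; see `yFactor_eq`. -/
def yFactor (q : ℂ) (x y : Fin n → ℂ) (k : Fin n → ℕ) : ℂ :=
  ∏ r, ∏ s, qPochHom q (x r / x s) (y s) (k r)

theorem yFactor_eq (q : ℂ) (x y : Fin n → ℂ) (hy : ∀ s, y s ≠ 0) (k : Fin n → ℕ) :
    yFactor q x y k =
      (∏ r, ∏ s, qPoch q (x r / (x s * y s)) (k r)) * (∏ s, y s) ^ size k := by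
  have h : ∀ r s, qPochHom q (x r / x s) (y s) (k r) =
      qPoch q (x r / (x s * y s)) (k r) * y s ^ k r := by
    intro r s
    rw [qPochHom_eq q _ (hy s), div_div, mul_comm]
  simp only [yFactor, h, Finset.prod_mul_distrib, Finset.prod_pow, size,
    Finset.prod_pow_eq_pow_sum]

/-- The prefactor
`(A, aAy_1⋯y_n/b)_∞ / (aA/b, Ay_1⋯y_n)_∞ · ∏_r (bqx_r y_r, aqx_r)_∞ / (aqx_r y_r, bqx_r)_∞`. -/
def prefactor (q a A b : ℂ) (x y : Fin n → ℂ) : ℂ :=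
  (qPochInf q A * qPochInf q (a * A * (∏ s, y s) / b)) /
      (qPochInf q (a * A / b) * qPochInf q (A * ∏ s, y s)) *
    ∏ r, (qPochInf q (b * q * x r * y r) * qPochInf q (a * q * x r)) /
      (qPochInf q (a * q * x r * y r) * qPochInf q (b * q * x r))

/-- The summand, indexed by `j`, of the series on the left-hand side. -/
def lhsTerm (q b : ℂ) (x y : Fin n → ℂ) (β : (Fin n → ℕ) → ℂ) (j : Fin n → ℕ) : ℂ :=
  vandermonde q x j * yFactor q x y j *
    (∏ r, (1 - b * x r * q ^ (j r + size j)) /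
      ((1 - b * x r) * qPoch q (b * q * x r * y r) (size j))) *
    powerq q j * β j

/-- The summand, indexed by `j ≤ k`, of the inner sum on the right-hand side. -/
def innerTerm (q a A b : ℂ) (x : Fin n → ℂ) (β : (Fin n → ℕ) → ℂ) (k j : Fin n → ℕ) : ℂ :=
  vandermonde q x j *
    (∏ r, ∏ s, qPoch q (q ^ (-(k s : ℤ)) * (x r / x s)) (j r)) *
    (∏ r, ((1 - b * x r * q ^ (j r + size j)) * qPoch q (a * x r * q ^ size k) (j r)) /
      ((1 - b * x r) * qPoch q (b * q * x r / A) (j r) *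
        qPoch q (b * x r * q ^ (k r + 1)) (size j))) *
    (qPoch q A (size j) / qPoch q (b * q ^ (1 - (size k : ℤ)) / a) (size j)) *
    powerq q j * (b * q / (a * A)) ^ size j * β j

/-- The summand, indexed by `k`, of the outer sum on the right-hand side; it contains the finite
inner sum over `0 ≤ j_r ≤ k_r`. -/
def rhsTerm (q a A b : ℂ) (x y : Fin n → ℂ) (β : (Fin n → ℕ) → ℂ) (k : Fin n → ℕ) : ℂ :=
  vandermonde q x k * yFactor q x y k *
    (∏ r, ∏ s, qPoch q (q * (x r / x s)) (k r))⁻¹ *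
    (∏ r, (1 - a * x r * q ^ (k r + size k)) / (1 - a * x r)) *
    (∏ r, (qPoch q (a * x r) (size k) * qPoch q (b * q * x r / A) (k r)) /
      (qPoch q (a * q * x r * y r) (size k) * qPoch q (b * q * x r) (k r))) *
    (qPoch q (a / b) (size k) / qPoch q (a * A / b) (size k)) *
    A ^ size k * powerq q k *
    ∑ j ∈ Finset.Iic k, innerTerm q a A b x β k j

/-- None of the denominators in the transformation formula vanishes at `y`, when the summation
indices are restricted to `I`. The remaining denominators `(aqx_r y_r)_{|k|}`, `(bqx_r)_{k_r}`,
`(aA/b)_{|k|}` and `(bx_r q^{k_r + 1})_{|j|}` divide infinite products listed here. -/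
structure DenomsNonzero (q a A b : ℂ) (x y : Fin n → ℂ) (I : Set (Fin n → ℕ)) : Prop where
  a_ne : a ≠ 0
  A_ne : A ≠ 0
  b_ne : b ≠ 0
  x_ne : ∀ r, x r ≠ 0
  x_distinct : ∀ r s, r ≠ s → x r ≠ x s
  one_sub_ax : ∀ r, 1 - a * x r ≠ 0
  one_sub_bx : ∀ r, 1 - b * x r ≠ 0
  aAb_inf : qPochInf q (a * A / b) ≠ 0
  Ay_inf : qPochInf q (A * ∏ s, y s) ≠ 0
  axy_inf : ∀ r, qPochInf q (a * q * x r * y r) ≠ 0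
  bx_inf : ∀ r, qPochInf q (b * q * x r) ≠ 0
  bxy : ∀ j ∈ I, ∀ r, qPoch q (b * q * x r * y r) (size j) ≠ 0
  x_quot : ∀ k ∈ I, ∀ r s, qPoch q (q * (x r / x s)) (k r) ≠ 0
  bxA : ∀ j ∈ I, ∀ r, qPoch q (b * q * x r / A) (j r) ≠ 0
  b_div_a : ∀ k ∈ I, ∀ j ≤ k, qPoch q (b * q ^ (1 - (size k : ℤ)) / a) (size j) ≠ 0

/-- The open polydisc `|y_r| < ρ_r` around the origin. -/
def polydisc (ρ : Fin n → ℝ) : Set (Fin n → ℂ) :=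
  {y | ∀ r, ‖y r‖ < ρ r}

end AnSeries

end

/-!
The terminating case carries the whole weight. At `y_r = q^{N_r}` both series are finite sums, and
after interchanging the two summations on the right-hand side it is enough to compare, for each
fixed `j ≤ N`, the coefficients of `β j`. On the right this coefficient is a sum over
`j ≤ k ≤ N`, a terminating very-well-poised `₆φ₅` sum of type `A`.

That sum is evaluated through a more symmetric identity, `sum_subsetTerm`, in which the summation
runs over all subsets `S` of a finite family of distinct points `x_u`, with weight
`∏_{u ∈ S, v ∉ S} (q x_v - x_u) / (x_v - x_u)`. Both sides are polynomials in the parameter `c`, of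
degree at most the number `m` of points, so it suffices to compare them at `m + 1` values of `c`.
At `c = 1 / x_w` only the subsets avoiding `w` contribute, and the identity reduces to the one for
`m - 1` points and parameter `c / q`; at `c = a q^m` only the full set contributes.

The `₆φ₅` sum arises by specializing the points to the geometric strings `x_r q^i`,
`j_r ≤ i < N_r`: the weight vanishes unless `S` consists of initial segments
`{x_r q^i | j_r ≤ i < k_r}` of the strings, and then it telescopes (`prod_strip_eq_stringWeight`).
This requires `a x_r q^i ≠ 1` for small `i`, which is not among the hypotheses; but after
simplification both sides are continuous in `a`, and the restriction disappears
(`sum_stringTerm`). The passage between the telescoped weight and the factors of the transformation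
formula rests on an evaluation of the factor `∏_{r,s} (q^{-k_s} x_r / x_s)_{k_r}` in terms of the
Vandermonde factor (`yFactor_self`).

In the non-terminating case the difference of the two sides is an analytic function of `y` on the
polydisc. It vanishes whenever all coordinates of `y` are powers of `q`, and these accumulate at
`0`, so the identity theorem in one variable, applied to one coordinate after the other, shows that
it vanishes on the whole polydisc (`eq_zero_on_polydisc`).
-/

namespace AnSeries

open Finset Polynomial

/-! ### A summation over subsets of a finite set of points -/

/-- The summand of `sum_subsetTerm` belonging to the subset `S` of the index set `s` of the points
`x u`. -/
def subsetTerm {K ι : Type*} [Field K] [DecidableEq ι] (q a e c : K) (x : ι → K)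
    (s S : Finset ι) : K :=
  (∏ i ∈ range #S, q ^ i * (a * q ^ (i + 1) - e)) *
    (∏ i ∈ Ico #S #s, (c - a * q ^ (i + 1))) *
    (∏ u ∈ S, ∏ v ∈ s \ S, (q * x v - x u) / (x v - x u)) *
    (∏ u ∈ S, (1 - c * x u) / (1 - a * q ^ #S * x u)) *
    ∏ v ∈ s \ S, (1 - e * x v) / (1 - a * q ^ (#S + 1) * x v)

section

variable {K ι : Type*} [Field K] [DecidableEq ι]

/-- At `c = 1 / x w`, the summand of a subset `S` that avoids `w` is, up to a factor independent of
`S`, the summand of `S` for the points other than `x w` and the parameter `c / q`. -/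
theorem subsetTerm_insert {q a e : K} {x : ι → K} (hq : q ≠ 0) {t S : Finset ι} {w : ι} (hw : w ∉ t)
    (hS : S ⊆ t) (hxw : x w ≠ 0) (hne : ∀ u ∈ t, x u ≠ x w)
    (ha : 1 - a * q ^ (#S + 1) * x w ≠ 0) :
    subsetTerm q a e (x w)⁻¹ x (insert w t) S =
      ((x w)⁻¹ - e) * q ^ #t * subsetTerm q a e ((x w)⁻¹ / q) x t S := by
  have hwS : w ∉ S := fun h => hw (hS h)
  have hsd : insert w t \ S = insert w (t \ S) := insert_sdiff_of_notMem _ hwS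
  have hw' : w ∉ t \ S := fun h => hw (mem_sdiff.1 h).1
  have hcard : #S ≤ #t := card_le_card hS
  have h1 : ∏ i ∈ Ico #S (#t + 1), ((x w)⁻¹ - a * q ^ (i + 1)) =
      ((x w)⁻¹ - a * q ^ (#S + 1)) * (q ^ (#t - #S) *
        ∏ i ∈ Ico #S #t, ((x w)⁻¹ / q - a * q ^ (i + 1))) := by
    rw [prod_eq_prod_Ico_succ_bot (by omega), ← prod_Ico_add' _ #S #t 1]
    congr 1
    rw [← Nat.card_Ico, ← prod_const, ← prod_mul_distrib]
    refine prod_congr rfl fun i _ => ?_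
    field_simp
    ring
  have h2 : (∏ u ∈ S, (q * x w - x u) / (x w - x u)) *
      ∏ u ∈ S, (1 - (x w)⁻¹ * x u) / (1 - a * q ^ #S * x u) =
      q ^ #S * ∏ u ∈ S, (1 - (x w)⁻¹ / q * x u) / (1 - a * q ^ #S * x u) := by
    rw [← prod_const, ← prod_mul_distrib, ← prod_mul_distrib]
    refine prod_congr rfl fun u hu => ?_
    have : x w - x u ≠ 0 := sub_ne_zero.2 (hne u (hS hu)).symm
    rw [← mul_div_assoc, ← mul_div_assoc]
    congr 1
    field_simp
  have h3 : ((x w)⁻¹ - a * q ^ (#S + 1)) * ((1 - e * x w) / (1 - a * q ^ (#S + 1) * x w)) =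
      (x w)⁻¹ - e := by
    rw [← mul_div_assoc, div_eq_iff ha]
    field_simp
  have h4 : q ^ #t = q ^ (#t - #S) * q ^ #S := by rw [← pow_add, Nat.sub_add_cancel hcard]
  unfold subsetTerm
  rw [hsd, card_insert_of_notMem hw, h1, prod_insert hw', h4, ← h3]
  simp only [prod_insert hw']
  rw [prod_mul_distrib (s := S) (f := fun u => (q * x w - x u) / (x w - x u))]
  generalize (1 - e * x w) / (1 - a * q ^ (#S + 1) * x w) = d
  linear_combination (∏ i ∈ range #S, q ^ i * (a * q ^ (i + 1) - e)) *
    ((x w)⁻¹ - a * q ^ (#S + 1)) * q ^ (#t - #S) *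
    (∏ i ∈ Ico #S #t, ((x w)⁻¹ / q - a * q ^ (i + 1))) *
    (∏ u ∈ S, ∏ v ∈ t \ S, (q * x v - x u) / (x v - x u)) *
    d *
    (∏ v ∈ t \ S, (1 - e * x v) / (1 - a * q ^ (#S + 1) * x v)) * h2

/-- The subset form of the terminating very-well-poised `₆φ₅` summation of type `A`. Both sides are
polynomials in `c` of degree at most `#s`, and they are compared at the `#s + 1` distinct points
`a q ^ #s` and `1 / x w`, `w ∈ s`. -/
theorem sum_subsetTerm {q a e : K} {x : ι → K} (hq : q ≠ 0) (s : Finset ι) (c : K)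
    (hx : ∀ u ∈ s, x u ≠ 0) (hinj : Set.InjOn x s)
    (ha : ∀ u ∈ s, ∀ m ∈ Icc 1 #s, 1 - a * q ^ m * x u ≠ 0) :
    ∑ S ∈ s.powerset, subsetTerm q a e c x s S = ∏ i ∈ range #s, (c - e * q ^ i) := by
  induction s using Finset.strongInduction generalizing c with
  | H s ih =>
  -- `P` is the difference of the two sides, as a polynomial in `c`
  let coef (S : Finset ι) : K :=
    (∏ i ∈ range #S, q ^ i * (a * q ^ (i + 1) - e)) *
    (∏ u ∈ S, ∏ v ∈ s \ S, (q * x v - x u) / (x v - x u)) *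
    (∏ u ∈ S, (1 - a * q ^ #S * x u))⁻¹ *
    ∏ v ∈ s \ S, (1 - e * x v) / (1 - a * q ^ (#S + 1) * x v)
  let P : K[X] := ∑ S ∈ s.powerset, C (coef S) * ((∏ i ∈ Ico #S #s, (X - C (a * q ^ (i + 1)))) *
    ∏ u ∈ S, (C (-x u) * X + C 1)) - ∏ i ∈ range #s, (X - C (e * q ^ i))
  have hP (c : K) : P.eval c =
      ∑ S ∈ s.powerset, subsetTerm q a e c x s S - ∏ i ∈ range #s, (c - e * q ^ i) := by
    simp only [P, eval_sub, eval_finsetSum, eval_mul, eval_C, eval_prod, eval_X, eval_add]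
    congr 1
    refine sum_congr rfl fun S _ => ?_
    simp only [coef, subsetTerm, prod_div_distrib (s := S) (f := fun u => 1 - c * x u)]
    have : ∏ u ∈ S, (1 - c * x u) = ∏ u ∈ S, (-x u * c + 1) := prod_congr rfl fun _ _ => by ring
    rw [this, div_eq_mul_inv]
    ring
  have hdeg : P.natDegree ≤ #s := by
    refine (natDegree_sub_le _ _).trans (max_le (natDegree_sum_le_of_forall_le _ _ ?_) ?_)
    · intro S hS
      have hS' : #S ≤ #s := card_le_card (mem_powerset.1 hS)
      refine (natDegree_C_mul_le _ _).trans (natDegree_mul_le.trans ?_)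
      refine (add_le_add (natDegree_prod_le _ _) (natDegree_prod_le _ _)).trans ?_
      refine (add_le_add (sum_le_card_nsmul _ _ 1 fun i _ => ?_)
        (sum_le_card_nsmul _ _ 1 fun i _ => ?_)).trans ?_
      · exact (natDegree_X_sub_C _).le
      · exact natDegree_linear_le
      · simp; omega
    · refine (natDegree_prod_le _ _).trans ((sum_le_card_nsmul _ _ 1 fun i _ => ?_).trans ?_)
      · exact (natDegree_X_sub_C _).le
      · simp
  -- at `c = a q ^ #s` the product over `Ico #S #s` vanishes unless `S = s`
  have htop : P.eval (a * q ^ #s) = 0 := by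
    rw [hP, sum_eq_single s]
    · have h1 : ∏ u ∈ s, (1 - a * q ^ #s * x u) / (1 - a * q ^ #s * x u) = 1 := by
        refine prod_eq_one fun u hu => div_self (ha u hu _ ?_)
        exact mem_Icc.2 ⟨card_pos.2 ⟨u, hu⟩, le_rfl⟩
      simp only [subsetTerm, Ico_self, prod_empty, Finset.sdiff_self, h1,
        prod_const_one, mul_one]
      rw [sub_eq_zero, prod_mul_distrib, ← prod_range_reflect (fun i => a * q ^ (i + 1) - e),
        ← prod_mul_distrib]
      refine prod_congr rfl fun i hi => ?_
      have : #s = i + (#s - 1 - i + 1) := by have := mem_range.1 hi; omega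
      nth_rw 2 [this]
      rw [pow_add]
      ring
    · intro S hS hne
      have hlt : #S < #s := card_lt_card ((mem_powerset.1 hS).ssubset_of_ne hne)
      have : ∏ i ∈ Ico #S #s, (a * q ^ #s - a * q ^ (i + 1)) = 0 := by
        refine prod_eq_zero (i := #s - 1) (mem_Ico.2 (by omega)) ?_
        rw [Nat.sub_add_cancel (by omega), sub_self]
      simp only [subsetTerm, this, mul_zero, zero_mul]
    · simp
  -- at `c = 1 / x w` the factor `1 - c * x w` removes all subsets that contain `w`
  have hinv : ∀ w ∈ s, P.eval (x w)⁻¹ = 0 := by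
    intro w hw
    have hne : ∀ u ∈ s.erase w, x u ≠ x w := fun u hu h =>
      (mem_erase.1 hu).1 (hinj (mem_erase.1 hu).2 hw h)
    have hcard : #s = #(s.erase w) + 1 := (card_erase_add_one hw).symm
    rw [hP, sub_eq_zero, ← sum_subset (powerset_mono.2 (erase_subset w s))]
    · have key : ∀ S ∈ (s.erase w).powerset, subsetTerm q a e (x w)⁻¹ x s S =
          ((x w)⁻¹ - e) * q ^ #(s.erase w) *
            subsetTerm q a e ((x w)⁻¹ / q) x (s.erase w) S := by
        intro S hS
        have hS' := card_le_card (mem_powerset.1 hS)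
        rw [← subsetTerm_insert hq (notMem_erase w s) (mem_powerset.1 hS) (hx w hw) hne
          (ha w hw _ (mem_Icc.2 (by omega))), insert_erase hw]
      rw [sum_congr rfl key, ← mul_sum, ih _ (erase_ssubset hw) _
        (fun u hu => hx u (mem_erase.1 hu).2) (hinj.mono (by simp))
        (fun u hu m hm => ha u (mem_erase.1 hu).2 m
          (mem_Icc.2 (by have := mem_Icc.1 hm; omega))), hcard, prod_range_succ']
      have h0 : q ^ #(s.erase w) * ∏ i ∈ range #(s.erase w), ((x w)⁻¹ / q - e * q ^ i) =
          ∏ i ∈ range #(s.erase w), ((x w)⁻¹ - e * q ^ (i + 1)) := by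
        rw [← card_range #(s.erase w), ← prod_const, card_range, ← prod_mul_distrib]
        refine prod_congr rfl fun i _ => ?_
        field_simp
        ring
      rw [← h0]
      ring
    · intro S hS hS'
      have hwS : w ∈ S := by
        by_contra h
        exact hS' (mem_powerset.2 (subset_erase.2 ⟨mem_powerset.1 hS, h⟩))
      have : ∏ u ∈ S, (1 - (x w)⁻¹ * x u) / (1 - a * q ^ #S * x u) = 0 :=
        prod_eq_zero hwS (by rw [inv_mul_cancel₀ (hx w hw), sub_self, zero_div])
      simp only [subsetTerm, this, mul_zero, zero_mul]
  have hzero : P = 0 := by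
    classical
    have hnot : a * q ^ #s ∉ s.image fun w => (x w)⁻¹ := by
      intro h
      obtain ⟨w, hw, h⟩ := mem_image.1 h
      refine ha w hw #s (mem_Icc.2 ⟨card_pos.2 ⟨w, hw⟩, le_rfl⟩) ?_
      rw [← h, inv_mul_cancel₀ (hx w hw), sub_self]
    refine eq_zero_of_natDegree_lt_card_of_eval_eq_zero' P
      (insert (a * q ^ #s) (s.image fun w => (x w)⁻¹)) ?_ ?_
    · intro c hc
      rcases mem_insert.1 hc with rfl | hc
      · exact htop
      · obtain ⟨w, hw, rfl⟩ := mem_image.1 hc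
        exact hinv w hw
    · rw [card_insert_of_notMem hnot, card_image_of_injOn fun u hu v hv h =>
        hinj hu hv (inv_injective h)]
      omega
  have := hP c
  rwa [hzero, eval_zero, eq_comm, sub_eq_zero] at this

end

/-! ### Specialization to geometric strings -/

theorem qPoch_add (q u : ℂ) (m l : ℕ) :
    qPoch q u (m + l) = qPoch q u m * qPoch q (u * q ^ m) l := by
  simp only [qPoch, prod_range_add, pow_add, mul_assoc]

theorem qPoch_ne_zero_iff {q u : ℂ} {m : ℕ} :
    qPoch q u m ≠ 0 ↔ ∀ i < m, 1 - u * q ^ i ≠ 0 := by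
  simp [qPoch, prod_ne_zero_iff]

/-- The index set of the points `x_r q^i` with `j_r ≤ i < k_r`: the pair `⟨r, i⟩` stands for
`x_r q^i`. -/
def strip {n : ℕ} (j k : Fin n → ℕ) : Finset (Σ _ : Fin n, ℕ) :=
  univ.sigma fun r => Ico (j r) (k r)

section strip
variable {n : ℕ} {j k N : Fin n → ℕ}

theorem mem_strip {p : Σ _ : Fin n, ℕ} : p ∈ strip j k ↔ j p.1 ≤ p.2 ∧ p.2 < k p.1 := by
  simp [strip]

theorem size_mono (h : j ≤ k) : size j ≤ size k := sum_le_sum fun r _ => h r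

theorem card_strip (h : j ≤ k) : #(strip j k) = size k - size j := by
  simp only [strip, card_sigma, Nat.card_Ico, size]
  exact sum_tsub_distrib _ fun r _ => h r

theorem strip_sdiff (hjk : j ≤ k) (hkN : k ≤ N) : strip j N \ strip j k = strip k N := by
  ext ⟨r, i⟩
  have h1 : j r ≤ k r := hjk r
  have h2 : k r ≤ N r := hkN r
  simp only [mem_sdiff, mem_strip]
  omega

theorem strip_injOn : Set.InjOn (strip j) (Icc j N : Finset (Fin n → ℕ)) := by
  intro k hk l hl h
  have key : ∀ k l : Fin n → ℕ, j ≤ l → strip j k ⊆ strip j l → k ≤ l := by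
    intro k l hl h r
    by_contra hlt
    have := mem_strip.1 (h (mem_strip.2 ⟨hl r, not_le.1 hlt⟩ : (⟨r, l r⟩ : Σ _ : Fin n, ℕ) ∈ _))
    exact lt_irrefl _ this.2
  simp only [coe_Icc, Set.mem_Icc] at hk hl
  exact le_antisymm (key k l hl.1 h.subset) (key l k hk.1 h.symm.subset)

/-- A subset of a family of strings that is closed under passing to the previous point of a string
consists of initial segments of the strings. -/
theorem exists_eq_strip (hjN : j ≤ N) {S : Finset (Σ _ : Fin n, ℕ)} (hS : S ⊆ strip j N)
    (hdown : ∀ r i, j r ≤ i → (⟨r, i + 1⟩ : Σ _ : Fin n, ℕ) ∈ S → ⟨r, i⟩ ∈ S) :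
    ∃ k ∈ Icc j N, strip j k = S := by
  have hex : ∀ r, ∃ i, j r ≤ i ∧ (⟨r, i⟩ : Σ _ : Fin n, ℕ) ∉ S := fun r =>
    ⟨N r, hjN r, fun h => by simpa using (mem_strip.1 (hS h)).2⟩
  refine ⟨fun r => Nat.find (hex r), mem_Icc.2 ⟨fun r => (Nat.find_spec (hex r)).1, fun r =>
    Nat.find_min' (hex r) ⟨hjN r, fun h => by simpa using (mem_strip.1 (hS h)).2⟩⟩, ?_⟩
  ext ⟨r, i⟩
  rw [mem_strip]
  constructor
  · rintro ⟨h1, h2⟩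
    by_contra h
    exact Nat.find_min (hex r) h2 ⟨h1, h⟩
  · intro h
    refine ⟨(mem_strip.1 (hS h)).1, ?_⟩
    by_contra hle
    push Not at hle
    have hspec := Nat.find_spec (hex r)
    have : ∀ m, Nat.find (hex r) ≤ m → (⟨r, m⟩ : Σ _ : Fin n, ℕ) ∉ S := by
      intro m hm
      induction m, hm using Nat.le_induction with
      | base => exact hspec.2
      | succ m hm ih => exact fun h => ih (hdown r m (hspec.1.trans hm) h)
    exact this i hle h

end strip

section
variable {n : ℕ} (q a e c : ℂ) (x : Fin n → ℂ) (j N k : Fin n → ℕ)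

/-- The weight of the initial segments `j_r ≤ i < k_r` in the strings `j_r ≤ i < N_r`, after
telescoping the product over the complement; see `prod_strip_eq_stringWeight`. -/
noncomputable def stringWeight : ℂ :=
  ∏ r, ∏ s, ∏ i ∈ Ico (j r) (k r),
    (x s * q ^ N s - x r * q ^ i) / (x s * q ^ k s - x r * q ^ i)

/-- The summand of the `₆φ₅` sum `sum_stringTerm`, with `k` as summation index. For generic `a`
it is `subsetTerm` for the initial segments `j_r ≤ i < k_r` of the strings, with parameter
`a q^{|j|}` and multiplied by `∏_r (a x_r; q)_{N_r + 1}`; this product cancels all denominators that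
depend on `a` apart from `(a x_r q^{N_r + 1}; q)_{|k|}`. -/
noncomputable def stringTerm : ℂ :=
  (∏ i ∈ range (size k - size j), q ^ i * (a * q ^ (size j + i + 1) - e)) *
    (∏ i ∈ Ico (size k) (size N), (c - a * q ^ (i + 1))) *
    stringWeight q x j N k *
    (∏ r, (1 - a * x r * q ^ (k r + size k)) * qPoch q (a * x r) (size k + j r) /
      qPoch q (a * x r * q ^ (N r + 1)) (size k)) *
    ∏ r, ((∏ i ∈ Ico (j r) (k r), (1 - c * (x r * q ^ i))) *
      ∏ i ∈ Ico (k r) (N r), (1 - e * (x r * q ^ i)))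

variable {q a e c x j N k}

/-- The weight of `subsetTerm` at initial segments of strings: the product over each complementary
segment `k_s ≤ l < N_s` telescopes. -/
theorem prod_strip_eq_stringWeight (hkN : k ≤ N)
    (hinj : ∀ r s i l, i ≤ N r → l ≤ N s → x r * q ^ i = x s * q ^ l → r = s ∧ i = l) :
    (∏ u ∈ strip j k, ∏ v ∈ strip k N,
      (q * (x v.1 * q ^ v.2) - x u.1 * q ^ u.2) / (x v.1 * q ^ v.2 - x u.1 * q ^ u.2)) =
      stringWeight q x j N k := by
  have key : ∀ r s, ∀ i ∈ Ico (j r) (k r), ∏ l ∈ Ico (k s) (N s),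
      (q * (x s * q ^ l) - x r * q ^ i) / (x s * q ^ l - x r * q ^ i) =
      (x s * q ^ N s - x r * q ^ i) / (x s * q ^ k s - x r * q ^ i) := by
    intro r s i hi
    have hi := mem_Ico.1 hi
    have hne : ∀ l, k s ≤ l → l ≤ N s → x s * q ^ l - x r * q ^ i ≠ 0 := by
      intro l h1 h2 h
      obtain ⟨rfl, rfl⟩ := hinj s r l i h2 (hi.2.le.trans (hkN r)) (sub_eq_zero.1 h)
      omega
    have : ∀ M, k s ≤ M → M ≤ N s → ∏ l ∈ Ico (k s) M,
        (q * (x s * q ^ l) - x r * q ^ i) / (x s * q ^ l - x r * q ^ i) =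
        (x s * q ^ M - x r * q ^ i) / (x s * q ^ k s - x r * q ^ i) := by
      intro M hM
      induction M, hM using Nat.le_induction with
      | base => intro h; rw [Ico_self, prod_empty, div_self (hne _ le_rfl h)]
      | succ M hM ih =>
        intro h
        rw [prod_Ico_succ_top hM, ih (by omega), div_mul_div_comm, mul_comm,
          mul_div_mul_right _ _ (hne M hM (by omega))]
        congr 1
        ring
    exact this _ (hkN s) le_rfl
  rw [strip, prod_sigma, stringWeight]
  refine prod_congr rfl fun r _ => ?_
  refine (prod_congr rfl fun i hi => ?_).trans prod_comm
  rw [strip, prod_sigma]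
  exact prod_congr rfl fun s _ => key r s i hi

/-- The denominators of `subsetTerm` that depend on `a`, collected over one string. -/
theorem qPoch_ratio {q u : ℂ} {K j k N : ℕ} (hjk : j ≤ k) (hkN : k ≤ N)
    (hu : ∀ i < N + 1 + K, 1 - u * q ^ i ≠ 0) :
    (1 - u * q ^ (k + K)) * qPoch q u (K + j) / qPoch q (u * q ^ (N + 1)) K =
      qPoch q u (N + 1) * ((∏ i ∈ Ico j k, (1 - u * q ^ (K + i))⁻¹) *
        ∏ i ∈ Ico k N, (1 - u * q ^ (K + i + 1))⁻¹) := by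
  have h1 : qPoch q (u * q ^ (N + 1)) K ≠ 0 := by
    have : qPoch q u (N + 1 + K) ≠ 0 := qPoch_ne_zero_iff.2 hu
    rw [qPoch_add] at this
    exact right_ne_zero_of_mul this
  have h2 : ∏ i ∈ Ico j k, (1 - u * q ^ (K + i)) ≠ 0 :=
    prod_ne_zero_iff.2 fun i hi => hu _ (by have := mem_Ico.1 hi; omega)
  have h3 : ∏ i ∈ Ico k N, (1 - u * q ^ (K + i + 1)) ≠ 0 :=
    prod_ne_zero_iff.2 fun i hi => hu _ (by have := mem_Ico.1 hi; omega)
  have h4 : qPoch q u (N + 1) * qPoch q (u * q ^ (N + 1)) K =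
      qPoch q u (K + j) * (∏ i ∈ Ico j k, (1 - u * q ^ (K + i))) * (1 - u * q ^ (k + K)) *
        ∏ i ∈ Ico k N, (1 - u * q ^ (K + i + 1)) := by
    have e1 : ∏ i ∈ Ico j k, (1 - u * q ^ (K + i)) =
        ∏ i ∈ Ico (K + j) (K + k), (1 - u * q ^ i) := by
      rw [add_comm K j, add_comm K k, ← prod_Ico_add']
      exact prod_congr rfl fun i _ => by rw [add_comm K i]
    have e2 : ∏ i ∈ Ico k N, (1 - u * q ^ (K + i + 1)) =
        ∏ i ∈ Ico (K + k + 1) (N + 1 + K), (1 - u * q ^ i) := by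
      rw [show K + k + 1 = k + (K + 1) by ring, show N + 1 + K = N + (K + 1) by ring,
        ← prod_Ico_add']
      exact prod_congr rfl fun i _ => by rw [add_comm K i, add_assoc]
    rw [← qPoch_add, e1, e2, add_comm k K, qPoch, qPoch, prod_range_mul_prod_Ico _ (by omega),
      ← prod_range_succ, prod_range_mul_prod_Ico _ (by omega)]
  rw [prod_inv_distrib, prod_inv_distrib]
  field_simp
  linear_combination -h4

theorem stringTerm_eq_subsetTerm (hjk : j ≤ k) (hkN : k ≤ N)
    (hinj : ∀ r s i l, i ≤ N r → l ≤ N s → x r * q ^ i = x s * q ^ l → r = s ∧ i = l)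
    (ha : ∀ r, ∀ i < N r + 1 + size N, 1 - a * x r * q ^ i ≠ 0) :
    stringTerm q a e c x j N k = (∏ r, qPoch q (a * x r) (N r + 1)) *
      subsetTerm q (a * q ^ size j) e c (fun p : Σ _ : Fin n, ℕ => x p.1 * q ^ p.2)
        (strip j N) (strip j k) := by
  have hJK := size_mono hjk
  have hKL := size_mono hkN
  have h1 : ∏ i ∈ Ico (size k - size j) (size N - size j),
      (c - a * q ^ size j * q ^ (i + 1)) = ∏ i ∈ Ico (size k) (size N), (c - a * q ^ (i + 1)) := by
    rw [← Nat.sub_add_cancel hJK, ← Nat.sub_add_cancel (hJK.trans hKL), ← prod_Ico_add',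
      Nat.add_sub_cancel, Nat.add_sub_cancel]
    exact prod_congr rfl fun i _ => by ring
  have h2 : (∏ u ∈ strip j k, (1 - c * (x u.1 * q ^ u.2)) /
        (1 - a * q ^ size j * q ^ (size k - size j) * (x u.1 * q ^ u.2))) *
      (∏ v ∈ strip k N, (1 - e * (x v.1 * q ^ v.2)) /
        (1 - a * q ^ size j * q ^ (size k - size j + 1) * (x v.1 * q ^ v.2))) =
      (∏ r, ((∏ i ∈ Ico (j r) (k r), (1 - c * (x r * q ^ i))) *
        ∏ i ∈ Ico (k r) (N r), (1 - e * (x r * q ^ i)))) *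
      ∏ r, ((∏ i ∈ Ico (j r) (k r), (1 - a * x r * q ^ (size k + i))⁻¹) *
        ∏ i ∈ Ico (k r) (N r), (1 - a * x r * q ^ (size k + i + 1))⁻¹) := by
    rw [strip, strip, prod_sigma, prod_sigma, ← prod_mul_distrib, ← prod_mul_distrib]
    refine prod_congr rfl fun r _ => ?_
    have e1 : ∀ i, a * q ^ size j * q ^ (size k - size j) * (x r * q ^ i) =
        a * x r * q ^ (size k + i) := fun i => by
      rw [mul_assoc a, ← pow_add, Nat.add_sub_cancel' hJK]; ring
    have e2 : ∀ i, a * q ^ size j * q ^ (size k - size j + 1) * (x r * q ^ i) =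
        a * x r * q ^ (size k + i + 1) := fun i => by
      rw [mul_assoc a, ← pow_add, ← add_assoc, Nat.add_sub_cancel' hJK]; ring
    simp only [e1, e2, div_eq_mul_inv, prod_mul_distrib]
    ring
  unfold stringTerm subsetTerm
  rw [strip_sdiff hjk hkN, card_strip hjk, card_strip (hjk.trans hkN), h1,
    prod_strip_eq_stringWeight hkN hinj, mul_assoc _ (∏ u ∈ strip j k, _), h2,
    prod_congr rfl fun r _ => qPoch_ratio (hjk r) (hkN r) fun i hi => ha r i (by omega),
    prod_mul_distrib (f := fun r => qPoch q (a * x r) (N r + 1))]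
  have h3 : ∏ i ∈ range (size k - size j), q ^ i * (a * q ^ size j * q ^ (i + 1) - e) =
      ∏ i ∈ range (size k - size j), q ^ i * (a * q ^ (size j + i + 1) - e) :=
    prod_congr rfl fun i _ => by ring
  rw [h3]
  ring

/-- The `₆φ₅` sum of type `A` for parameters `a` at which no denominator of `subsetTerm` vanishes. -/
theorem sum_stringTerm_of_generic (hq : q ≠ 0) (hjN : j ≤ N) (hx : ∀ r, x r ≠ 0)
    (hinj : ∀ r s i l, i ≤ N r → l ≤ N s → x r * q ^ i = x s * q ^ l → r = s ∧ i = l)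
    (ha : ∀ r, ∀ i < N r + 1 + size N, 1 - a * x r * q ^ i ≠ 0) :
    ∑ k ∈ Icc j N, stringTerm q a e c x j N k =
      (∏ r, qPoch q (a * x r) (N r + 1)) * ∏ i ∈ range (size N - size j), (c - e * q ^ i) := by
  have hJL := size_mono hjN
  rw [← card_strip hjN, ← sum_subsetTerm (a := a * q ^ size j)
    (x := fun p : Σ _ : Fin n, ℕ => x p.1 * q ^ p.2) hq (strip j N) c, mul_sum]
  · rw [sum_congr rfl fun k hk => stringTerm_eq_subsetTerm (mem_Icc.1 hk).1 (mem_Icc.1 hk).2 hinj ha,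
      ← sum_image (f := fun S => (∏ r, qPoch q (a * x r) (N r + 1)) *
        subsetTerm q (a * q ^ size j) e c (fun p : Σ _ : Fin n, ℕ => x p.1 * q ^ p.2)
        (strip j N) S) strip_injOn]
    refine sum_subset ?_ ?_
    · intro S hS
      obtain ⟨k, hk, rfl⟩ := mem_image.1 hS
      have := (mem_Icc.1 hk).2
      refine mem_powerset.2 fun p hp => mem_strip.2 ?_
      have h1 := mem_strip.1 hp
      exact ⟨h1.1, h1.2.trans_le (this _)⟩
    · intro S hS hS'
      have hS := mem_powerset.1 hS
      obtain ⟨r, i, hi, h1, h2⟩ : ∃ r i, j r ≤ i ∧ (⟨r, i + 1⟩ : Σ _ : Fin n, ℕ) ∈ S ∧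
          (⟨r, i⟩ : Σ _ : Fin n, ℕ) ∉ S := by
        by_contra! h
        obtain ⟨k, hk, rfl⟩ := exists_eq_strip hjN hS h
        exact hS' (mem_image_of_mem _ hk)
      have h3 : (⟨r, i⟩ : Σ _ : Fin n, ℕ) ∈ strip j N \ S := by
        have := (mem_strip.1 (hS h1)).2
        exact mem_sdiff.2 ⟨mem_strip.2 ⟨hi, by simp at this ⊢; omega⟩, h2⟩
      -- the factor with `u = ⟨r, i + 1⟩`, `v = ⟨r, i⟩` has numerator `q * (x_r q^i) - x_r q^{i + 1}`
      have : ∏ u ∈ S, ∏ v ∈ strip j N \ S,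
          (q * (x v.1 * q ^ v.2) - x u.1 * q ^ u.2) / (x v.1 * q ^ v.2 - x u.1 * q ^ u.2) = 0 := by
        refine prod_eq_zero h1 (prod_eq_zero h3 ?_)
        simp only [pow_succ]
        rw [div_eq_zero_iff]
        left; ring
      simp only [subsetTerm, this, mul_zero, zero_mul]
  · exact fun p _ => mul_ne_zero (hx _) (pow_ne_zero _ hq)
  · rintro ⟨r, i⟩ hu ⟨s, l⟩ hv h
    have h1 := mem_strip.1 hu
    have h2 := mem_strip.1 hv
    obtain ⟨rfl, rfl⟩ := hinj r s i l h1.2.le h2.2.le h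
    rfl
  · rintro ⟨r, i⟩ hu m hm
    have h1 := mem_strip.1 hu
    have h2 := mem_Icc.1 hm
    rw [card_strip hjN] at h2
    have := ha r (size j + m + i) (by simp at h1; omega)
    convert this using 2
    ring

/-- The terminating very-well-poised `₆φ₅` summation of type `A`. Both sides are continuous in `a`,
and near any admissible `a` all other values are generic. -/
theorem sum_stringTerm (hq : q ≠ 0) (hjN : j ≤ N) (hx : ∀ r, x r ≠ 0)
    (hinj : ∀ r s i l, i ≤ N r → l ≤ N s → x r * q ^ i = x s * q ^ l → r = s ∧ i = l)
    (ha : ∀ r i, 1 - a * x r * q ^ (N r + 1) * q ^ i ≠ 0) :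
    ∑ k ∈ Icc j N, stringTerm q a e c x j N k =
      (∏ r, qPoch q (a * x r) (N r + 1)) * ∏ i ∈ range (size N - size j), (c - e * q ^ i) := by
  have hgen : ∀ᶠ a' in nhdsWithin a {a}ᶜ,
      ∀ r, ∀ i < N r + 1 + size N, 1 - a' * x r * q ^ i ≠ 0 := by
    refine Filter.eventually_all.2 fun r => ?_
    refine (Filter.eventually_all_finite (Set.finite_Iio _)).2 fun i _ => ?_
    have hz : x r * q ^ i ≠ 0 := mul_ne_zero (hx r) (pow_ne_zero _ hq)
    have hne : ∀ᶠ a' in nhdsWithin a {a}ᶜ, a' ≠ (x r * q ^ i)⁻¹ := by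
      by_cases h : a = (x r * q ^ i)⁻¹
      · rw [← h]
        exact eventually_mem_nhdsWithin
      · exact eventually_ne_nhdsWithin h
    filter_upwards [hne] with a' h h0
    exact h (eq_inv_of_mul_eq_one_left (by linear_combination -h0))
  have hL : ContinuousAt (fun a' => ∑ k ∈ Icc j N, stringTerm q a' e c x j N k) a := by
    have hp : ∀ r k, ContinuousAt (fun a' => (1 - a' * x r * q ^ (k r + size k)) *
        qPoch q (a' * x r) (size k + j r) / qPoch q (a' * x r * q ^ (N r + 1)) (size k)) a := by
      intro r k
      refine ContinuousAt.div ?_ ?_ (qPoch_ne_zero_iff.2 fun i _ => ha r i)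
      · simp only [qPoch]; fun_prop
      · simp only [qPoch]; fun_prop
    simp only [stringTerm]
    fun_prop
  have hR : ContinuousAt (fun a' => (∏ r, qPoch q (a' * x r) (N r + 1)) *
      ∏ i ∈ range (size N - size j), (c - e * q ^ i)) a := by
    simp only [qPoch]
    fun_prop
  refine tendsto_nhds_unique_of_eventuallyEq (hL.tendsto.mono_left nhdsWithin_le_nhds)
    (hR.tendsto.mono_left nhdsWithin_le_nhds) (l := nhdsWithin a {a}ᶜ) ?_
  filter_upwards [hgen] with a' h
  exact sum_stringTerm_of_generic hq hjN hx hinj h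

end

/-! ### The Vandermonde factor -/

theorem sq_eq_add_two_mul_choose (m : ℕ) : m * m = m + 2 * m.choose 2 := by
  induction m with
  | zero => rfl
  | succ m ih => rw [Nat.choose_succ_succ' m 1, Nat.choose_one_right]; linarith

theorem choose_two_add (m l : ℕ) :
    (m + l).choose 2 = m.choose 2 + l.choose 2 + m * l := by
  have h1 := sq_eq_add_two_mul_choose m
  have h2 := sq_eq_add_two_mul_choose l
  have h3 := sq_eq_add_two_mul_choose (m + l)
  linarith

theorem prod_range_pow_id (q : ℂ) (m : ℕ) : ∏ i ∈ range m, q ^ i = q ^ m.choose 2 := by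
  rw [prod_pow_eq_pow_sum, sum_range_id, Nat.choose_two_right]

theorem pow_eq_prod_range (c : ℂ) (m : ℕ) : c ^ m = ∏ _i ∈ range m, c := by simp

/-- The contribution of a pair `r < s` to `yFactor_self`, where `X = x_r / x_s`, `m = k_r` and
`l = k_s`. The factor `1 - q^{m - l} X` of the Vandermonde product appears, multiplied by `q^l`, as
the last factor of `qPochHom q X (q ^ l) (m + 1)`. -/
theorem qPochHom_mul_qPochHom_inv (q : ℂ) {X : ℂ} (hX : X ≠ 0) (m l : ℕ) :
    qPochHom q X (q ^ l) (m + 1) * qPochHom q X⁻¹ (q ^ m) l =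
      q ^ (m * l) * (1 - X) * (qPoch q (q * X) m * qPoch q (q * X⁻¹) l) := by
  induction l with
  | zero =>
    rw [qPochHom, prod_range_succ']
    simp only [qPochHom, qPoch, pow_zero, prod_range_zero, mul_zero, mul_one, one_mul]
    rw [mul_comm]
    congr 1
    exact prod_congr rfl fun i _ => by ring
  | succ l ih =>
    have h1 : qPochHom q X (q ^ (l + 1)) (m + 1) =
        (q ^ (l + 1) - X) * (q ^ m * qPochHom q X (q ^ l) m) := by
      rw [qPochHom, prod_range_succ', pow_zero, mul_one, mul_comm, qPochHom]
      congr 1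
      rw [pow_eq_prod_range q m, ← prod_mul_distrib]
      exact prod_congr rfl fun i _ => by ring
    have h2 : qPochHom q X (q ^ l) (m + 1) = qPochHom q X (q ^ l) m * (q ^ l - X * q ^ m) :=
      prod_range_succ _ _
    have h3 : qPochHom q X⁻¹ (q ^ m) (l + 1) =
        qPochHom q X⁻¹ (q ^ m) l * (q ^ m - X⁻¹ * q ^ l) := prod_range_succ _ _
    have h4 : qPoch q (q * X⁻¹) (l + 1) = qPoch q (q * X⁻¹) l * (1 - q * X⁻¹ * q ^ l) :=
      prod_range_succ _ _
    have h5 : q ^ m - X⁻¹ * q ^ l = -X⁻¹ * (q ^ l - X * q ^ m) := by field_simp; ring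
    have h6 : 1 - q * X⁻¹ * q ^ l = -X⁻¹ * (q ^ (l + 1) - X) := by field_simp; ring
    rw [h2] at ih
    rw [h1, h3, h4, h5, h6, mul_add, mul_one, pow_add]
    linear_combination (q ^ (l + 1) - X) * q ^ m * (-X⁻¹) * ih

/-- The contribution of a diagonal pair `r = s` to `yFactor_self`. -/
theorem qPochHom_one_self (q : ℂ) (m : ℕ) :
    qPochHom q 1 (q ^ m) m = (-1) ^ m * q ^ m.choose 2 * qPoch q q m := by
  rw [qPoch, ← prod_range_reflect, ← prod_range_pow_id]
  rw [pow_eq_prod_range (-1), ← prod_mul_distrib, ← prod_mul_distrib]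
  refine prod_congr rfl fun i hi => ?_
  have : m = i + (m - 1 - i + 1) := by have := mem_range.1 hi; omega
  nth_rw 1 [this]
  ring

theorem prod_prod_eq_diag_mul {M : Type*} [CommMonoid M] {n : ℕ} (f : Fin n → Fin n → M) :
    ∏ r, ∏ s, f r s = (∏ r, f r r) * ∏ r, ∏ s ∈ Ioi r, (f r s * f s r) := by
  have h := prod_prod_Ioi_mul_eq_prod_prod_off_diag (fun r s => f s r)
  rw [h, ← prod_mul_distrib]
  refine prod_congr rfl fun r _ => ?_
  rw [← mul_prod_erase univ (f r) (mem_univ r)]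
  congr 1
  exact prod_congr (by ext; simp) fun _ _ => rfl

theorem sum_mul_eq_sum_Ioi {n : ℕ} (k : Fin n → ℕ) :
    ∑ r : Fin n, (r : ℕ) * k r = ∑ r, ∑ s ∈ Ioi r, k s := by
  rw [sum_comm' (t' := univ) (s' := fun s => Iio s) (by simp)]
  simp

theorem choose_two_size {n : ℕ} (k : Fin n → ℕ) :
    (size k).choose 2 = ∑ r, (k r).choose 2 + ∑ r, ∑ s ∈ Ioi r, k r * k s := by
  have h1 := sq_eq_add_two_mul_choose (size k)
  have h2 : size k * size k = ∑ r, k r * k r + 2 * ∑ r, ∑ s ∈ Ioi r, k r * k s := by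
    rw [size, sum_mul_sum]
    have := congrArg Multiplicative.toAdd
      (prod_prod_eq_diag_mul fun r s => Multiplicative.ofAdd (k r * k s))
    simp only [toAdd_prod, toAdd_mul, toAdd_ofAdd] at this
    rw [this, mul_sum]
    congr 1
    refine sum_congr rfl fun r _ => ?_
    rw [mul_sum]
    exact sum_congr rfl fun s _ => by ring
  rw [h2, sum_congr rfl fun r _ => sq_eq_add_two_mul_choose (k r), sum_add_distrib, ← mul_sum] at h1
  simp only [size] at h1 ⊢
  linarith

/-- Up to the power `q ^ (|k| * |k|)`, the first factor is `∏_{r,s} (q^{-k_s} x_r / x_s; q)_{k_r}`. The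
identity follows by comparing the factors of each pair of indices. -/
theorem yFactor_self {n : ℕ} {q : ℂ} (hq : q ≠ 0) {x : Fin n → ℂ} (hx : ∀ r, x r ≠ 0)
    (hne : ∀ r s, r ≠ s → x r ≠ x s) (k : Fin n → ℕ) :
    yFactor q x (fun r => q ^ k r) k * (vandermonde q x k * powerq q k) =
      (-1) ^ size k * q ^ (size k).choose 2 * ∏ r, ∏ s, qPoch q (q * (x r / x s)) (k r) := by
  rw [yFactor, prod_prod_eq_diag_mul, vandermonde, powerq, sum_mul_eq_sum_Ioi, choose_two_size,
    prod_prod_eq_diag_mul (fun r s => qPoch q (q * (x r / x s)) (k r))]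
  simp only [← prod_pow_eq_pow_sum, pow_add, size, div_self (hx _), mul_one, qPochHom_one_self,
    prod_mul_distrib (s := univ) (f := fun r => (-1) ^ k r * q ^ (k r).choose 2),
    prod_mul_distrib (s := univ) (f := fun r => (-1 : ℂ) ^ k r)]
  have : (∏ r, ∏ s ∈ Ioi r, qPochHom q (x r / x s) (q ^ k s) (k r) *
      qPochHom q (x s / x r) (q ^ k r) (k s)) *
      ((∏ r, ∏ s ∈ Ioi r, (1 - q ^ ((k r : ℤ) - (k s : ℤ)) * (x r / x s)) / (1 - x r / x s)) *
        ∏ r, ∏ s ∈ Ioi r, q ^ k s) = (∏ r, ∏ s ∈ Ioi r, q ^ (k r * k s)) *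
      ∏ r, ∏ s ∈ Ioi r, qPoch q (q * (x r / x s)) (k r) * qPoch q (q * (x s / x r)) (k s) := by
    simp only [← prod_mul_distrib]
    refine prod_congr rfl fun r _ => prod_congr rfl fun s hs => ?_
    have h1 := qPochHom_mul_qPochHom_inv q (div_ne_zero (hx r) (hx s)) (k r) (k s)
    have h2 : 1 - x r / x s ≠ 0 := by
      rw [sub_ne_zero, ne_comm, Ne, div_eq_one_iff_eq (hx s)]
      exact hne r s (mem_Ioi.1 hs).ne
    rw [inv_div] at h1
    have h3 : qPochHom q (x r / x s) (q ^ k s) (k r + 1) =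
      qPochHom q (x r / x s) (q ^ k s) (k r) * (q ^ k s - x r / x s * q ^ k r) :=
        prod_range_succ _ _
    have h4 : (1 - q ^ ((k r : ℤ) - (k s : ℤ)) * (x r / x s)) * q ^ k s =
        q ^ k s - x r / x s * q ^ k r := by
      rw [zpow_sub₀ hq, zpow_natCast, zpow_natCast]
      have := pow_ne_zero (k s) hq
      have := hx s
      field_simp
    rw [h3, ← h4] at h1
    field_simp at h1 ⊢
    linear_combination h1
  linear_combination ((∏ r, (-1) ^ k r) * (∏ r, q ^ (k r).choose 2) *
    ∏ r, qPoch q q (k r)) * this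

/-! ### The coefficient of `β j` in the terminating case -/

section

variable {n : ℕ} {q a A b : ℂ} {x : Fin n → ℂ} {j k N : Fin n → ℕ}

theorem yFactor_ne_zero (hx : ∀ r, x r ≠ 0) (hkN : k ≤ N)
    (hinj : ∀ r s i l, i ≤ N r → l ≤ N s → x r * q ^ i = x s * q ^ l → r = s ∧ i = l) :
    yFactor q x (fun r => q ^ k r) k ≠ 0 := by
  refine prod_ne_zero_iff.2 fun r _ => prod_ne_zero_iff.2 fun s _ =>
    prod_ne_zero_iff.2 fun i hi h => ?_
  have hi := mem_range.1 hi
  have hxs := hx s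
  obtain ⟨rfl, rfl⟩ := hinj r s i (k s) (hi.le.trans (hkN r)) (hkN s) (by
    field_simp at h
    linear_combination -h)
  exact lt_irrefl _ hi

theorem stringWeight_mul_yFactor (hx : ∀ r, x r ≠ 0) (hjk : j ≤ k)
    (hk : yFactor q x (fun r => q ^ k r) k ≠ 0) :
    stringWeight q x j N k * yFactor q x (fun r => q ^ N r) j =
      yFactor q x (fun r => q ^ N r) k * yFactor q x (fun r => q ^ k r) j /
        yFactor q x (fun r => q ^ k r) k := by
  have h1 : ∀ M : Fin n → ℕ, yFactor q x (fun r => q ^ M r) k =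
      yFactor q x (fun r => q ^ M r) j *
        ∏ r, ∏ s, ∏ i ∈ Ico (j r) (k r), (q ^ M s - x r / x s * q ^ i) := by
    intro M
    simp only [yFactor, qPochHom, ← prod_mul_distrib]
    exact prod_congr rfl fun r _ => prod_congr rfl fun s _ =>
      (prod_range_mul_prod_Ico _ (hjk r)).symm
  have h2 : stringWeight q x j N k =
      (∏ r, ∏ s, ∏ i ∈ Ico (j r) (k r), (q ^ N s - x r / x s * q ^ i)) /
        ∏ r, ∏ s, ∏ i ∈ Ico (j r) (k r), (q ^ k s - x r / x s * q ^ i) := by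
    simp only [stringWeight, ← prod_div_distrib]
    refine prod_congr rfl fun r _ => prod_congr rfl fun s _ => prod_congr rfl fun i _ => ?_
    have hxs := hx s
    rw [← mul_div_mul_left (_ - x r / x s * q ^ i) _ hxs]
    congr 1 <;> field_simp
  rw [h1 k] at hk
  have := left_ne_zero_of_mul hk
  have := right_ne_zero_of_mul hk
  rw [h2, h1 k, h1 N]
  field_simp

/-- The factors of the two sums on the right-hand side that depend on the quotients `x_r / x_s`, at
`y_r = q^{N_r}`, in terms of the telescoped weight. -/
theorem vandermonde_mul_yFactor (hq : q ≠ 0) (hx : ∀ r, x r ≠ 0)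
    (hne : ∀ r s, r ≠ s → x r ≠ x s) (hjk : j ≤ k)
    (hk : yFactor q x (fun r => q ^ k r) k ≠ 0)
    (hk' : ∏ r, ∏ s, qPoch q (q * (x r / x s)) (k r) ≠ 0) :
    vandermonde q x k * yFactor q x (fun r => q ^ N r) k *
        (∏ r, ∏ s, qPoch q (q * (x r / x s)) (k r))⁻¹ * powerq q k *
        (∏ r, ∏ s, qPoch q (q ^ (-(k s : ℤ)) * (x r / x s)) (j r)) =
      (-1) ^ size k * q ^ (size k).choose 2 * (q ^ (size k * size j))⁻¹ *
        (stringWeight q x j N k * yFactor q x (fun r => q ^ N r) j) := by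
  have h1 := yFactor_self hq hx hne k
  have h2 := yFactor_eq q x (fun r => q ^ k r) (fun s => pow_ne_zero _ hq) j
  have h3 : ∏ r, ∏ s, qPoch q (q ^ (-(k s : ℤ)) * (x r / x s)) (j r) =
      ∏ r, ∏ s, qPoch q (x r / (x s * q ^ k s)) (j r) := by
    refine prod_congr rfl fun r _ => prod_congr rfl fun s _ => ?_
    rw [zpow_neg, zpow_natCast, inv_mul_eq_div, div_div]
  rw [prod_pow_eq_pow_sum, ← size, ← pow_mul] at h2
  have hp := pow_ne_zero (size k * size j) hq
  rw [stringWeight_mul_yFactor hx hjk hk, h3, h2]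
  generalize ∏ r, ∏ s, qPoch q (q * (x r / x s)) (k r) = B at *
  field_simp
  linear_combination (yFactor q x (fun r => q ^ N r) k *
    ∏ r, ∏ s, qPoch q (x r / (x s * q ^ k s)) (j r)) * h1

/-- The factors containing `b x_r`, for a single index `r`, in terms of those of `stringTerm`. -/
theorem qPoch_quotient_eq {c b A x : ℂ} {j k N J : ℕ} (hjk : j ≤ k) (hkN : k ≤ N)
    (hb : qPoch q (b * q * x) (N + J) ≠ 0) (hA : qPoch q (b * q * x / A) j ≠ 0)
    (hc : c = b * q / A) :
    qPoch q (b * q * x / A) k / (qPoch q (b * q * x) k *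
      (qPoch q (b * q * x / A) j * qPoch q (b * x * q ^ (k + 1)) J)) =
    ((∏ i ∈ Ico j k, (1 - c * (x * q ^ i))) *
      ∏ i ∈ Ico k N, (1 - b * q ^ (J + 1) * (x * q ^ i))) / qPoch q (b * q * x) (N + J) := by
  have h1 : qPoch q (b * q * x / A) k =
      qPoch q (b * q * x / A) j * ∏ i ∈ Ico j k, (1 - c * (x * q ^ i)) := by
    rw [qPoch, qPoch, ← prod_range_mul_prod_Ico _ hjk, hc]
    congr 1
    exact prod_congr rfl fun i _ => by ring
  have h2 : qPoch q (b * q * x) (N + J) = qPoch q (b * q * x) k * qPoch q (b * x * q ^ (k + 1)) J *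
      ∏ i ∈ Ico k N, (1 - b * q ^ (J + 1) * (x * q ^ i)) := by
    rw [show b * x * q ^ (k + 1) = b * q * x * q ^ k by ring, ← qPoch_add, qPoch, qPoch,
      ← prod_range_mul_prod_Ico _ (show k + J ≤ N + J by omega), ← prod_Ico_add']
    congr 1
    exact prod_congr rfl fun i _ => by ring
  rw [h2] at hb
  have := left_ne_zero_of_mul (left_ne_zero_of_mul hb)
  have := right_ne_zero_of_mul (left_ne_zero_of_mul hb)
  have := right_ne_zero_of_mul hb
  rw [h2, h1]
  generalize ∏ i ∈ Ico k N, (1 - b * q ^ (J + 1) * (x * q ^ i)) = P at *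
  field_simp

/-- The factors containing `a / b` and its inverse, together with all powers of `q` and `A` in the
right-hand side of the transformation formula, where `K = |k|` and `J = |j|`. The denominator
is reversed by means of `1 - (b/a) q^{-m} = -(b/a) q^{-m} (1 - (a/b) q^m)`. -/
theorem qPoch_div_qPoch_reflect {J M K : ℕ} (hK : K = J + M) (hq : q ≠ 0) (ha : a ≠ 0) (hb : b ≠ 0)
    (hA : A ≠ 0) (h : qPoch q (b * q ^ (1 - (K : ℤ)) / a) J ≠ 0) :
    (-1) ^ K * q ^ K.choose 2 * (q ^ (K * J))⁻¹ * A ^ K * (b * q / (a * A)) ^ J *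
      (qPoch q (a / b) K / qPoch q (b * q ^ (1 - (K : ℤ)) / a) J) =
    (∏ i ∈ range M, q ^ i * (a * q ^ (J + i + 1) - b * q ^ (J + 1))) *
      ((b * q / A) ^ M)⁻¹ := by
  subst hK
  have h1 : qPoch q (b * q ^ (1 - ((J + M : ℕ) : ℤ)) / a) J *
      ((-a / b) ^ J * (q ^ (M * J) * q ^ J.choose 2)) = qPoch q (a / b * q ^ M) J := by
    rw [pow_mul, ← prod_range_pow_id, qPoch, ← prod_range_reflect, qPoch]
    rw [pow_eq_prod_range (-a / b), pow_eq_prod_range (q ^ M), ← prod_mul_distrib, ← prod_mul_distrib, ← prod_mul_distrib]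
    refine prod_congr rfl fun i hi => ?_
    have hi := mem_range.1 hi
    have h2 : q ^ (1 - ((J + M : ℕ) : ℤ)) * q ^ (J - 1 - i) = (q ^ (M + i))⁻¹ := by
      rw [← zpow_natCast, ← zpow_natCast, ← zpow_neg, ← zpow_add₀ hq]
      congr 1
      push_cast [Nat.sub_sub, Nat.cast_sub (show 1 + i ≤ J by omega)]
      ring
    have h3 : b * q ^ (1 - ((J + M : ℕ) : ℤ)) / a * q ^ (J - 1 - i) = b / a * (q ^ (M + i))⁻¹ := by
      rw [← h2]; ring
    rw [h3, pow_add]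
    have := pow_ne_zero M hq
    have := pow_ne_zero i hq
    field_simp
    ring
  have h2 : qPoch q (a / b) (J + M) / qPoch q (b * q ^ (1 - ((J + M : ℕ) : ℤ)) / a) J =
      qPoch q (a / b) M * ((-a / b) ^ J * (q ^ (M * J) * q ^ J.choose 2)) := by
    rw [div_eq_iff h, add_comm J M, qPoch_add, ← h1, add_comm J M]
    ring
  have h3 : ∏ i ∈ range M, q ^ i * (a * q ^ (J + i + 1) - b * q ^ (J + 1)) =
      q ^ M.choose 2 * ((-(b * q ^ (J + 1))) ^ M * qPoch q (a / b) M) := by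
    rw [← prod_range_pow_id, qPoch]
    rw [pow_eq_prod_range (-(b * q ^ (J + 1))), ← prod_mul_distrib, ← prod_mul_distrib]
    refine prod_congr rfl fun i _ => ?_
    field_simp
    ring
  have h4 : q ^ ((J + M) * J) = q ^ J * q ^ J.choose 2 * q ^ J.choose 2 * q ^ (M * J) := by
    rw [add_mul, sq_eq_add_two_mul_choose J]; ring
  have hJ := pow_ne_zero J hq
  have hJ2 := pow_ne_zero (J.choose 2) hq
  have hMJ := pow_ne_zero (M * J) hq
  rw [h2, h3, h4, choose_two_add, mul_comm J M]
  have h5 : (b * q ^ (J + 1)) ^ M = b ^ M * q ^ (M * J) * q ^ M := by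
    rw [mul_pow, ← pow_mul]; ring
  rw [neg_pow (b * q ^ (J + 1)), h5, neg_div, neg_pow (a / b)]
  simp only [pow_add, div_pow, mul_pow]
  field_simp
  have : ((-1 : ℂ) ^ J) ^ 2 = 1 := by rw [← pow_mul, mul_comm, pow_mul]; simp
  linear_combination qPoch q (a / b) M * this

theorem qPochInf_eq (hq1 : ‖q‖ < 1) (u : ℂ) (m : ℕ) :
    qPochInf q u = qPoch q u m * qPochInf q (u * q ^ m) := by
  have e : ∀ i, 1 - u * q ^ (i + m) = 1 - u * q ^ m * q ^ i := fun i => by ring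
  have h : Multipliable fun i => 1 - u * q ^ (i + m) := by
    simpa only [e] using multipliable_qPochInf hq1 (u * q ^ m)
  have h' := Multipliable.prod_mul_tprod_nat_mul' (f := fun i => 1 - u * q ^ i) h
  simp only [e] at h'
  exact h'.symm

theorem qPoch_ne_zero_of_qPochInf (hq1 : ‖q‖ < 1) {u : ℂ} (h : qPochInf q u ≠ 0) (m : ℕ) :
    qPoch q u m ≠ 0 := by
  rw [qPochInf_eq hq1 u m] at h
  exact left_ne_zero_of_mul h

/-- Nonvanishing of the denominators `(q x_r / x_s; q)_{k_r}` means that the points `x_r q^i`,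
`0 ≤ i ≤ N_r`, are distinct. -/
theorem DenomsNonzero.injective {y : Fin n → ℂ} (hq0 : q ≠ 0)
    (D : DenomsNonzero q a A b x y (Set.Iic N)) :
    ∀ r s i l, i ≤ N r → l ≤ N s → x r * q ^ i = x s * q ^ l → r = s ∧ i = l := by
  have key : ∀ r s i l, i ≤ N r → l < i → x r * q ^ i ≠ x s * q ^ l := by
    intro r s i l hi hl h
    refine qPoch_ne_zero_iff.1 (D.x_quot N (Set.mem_Iic.2 le_rfl) r s) (i - l - 1) (by omega) ?_
    obtain ⟨d, rfl⟩ : ∃ d, i = l + d + 1 := ⟨i - l - 1, by omega⟩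
    have hs := D.x_ne s
    have hl := pow_ne_zero l hq0
    have : x r * q ^ (d + 1) = x s := by
      apply mul_right_cancel₀ hl
      linear_combination h
    rw [show l + d + 1 - l - 1 = d by omega]
    field_simp
    linear_combination -this
  intro r s i l hi hl h
  rcases lt_trichotomy i l with h1 | rfl | h1
  · exact absurd h.symm (key s r l i hl h1)
  · refine ⟨?_, rfl⟩
    by_contra hrs
    exact D.x_distinct r s hrs (mul_right_cancel₀ (pow_ne_zero i hq0) h)
  · exact absurd h (key r s i l hi h1)

theorem yFactor_eq_zero (hx : ∀ r, x r ≠ 0) (hk : ¬ k ≤ N) :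
    yFactor q x (fun r => q ^ N r) k = 0 := by
  obtain ⟨r, hr⟩ : ∃ r, N r < k r := by
    simpa [Pi.le_def] using hk
  refine prod_eq_zero (mem_univ r) (prod_eq_zero (mem_univ r) (prod_eq_zero (mem_range.2 hr) ?_))
  rw [div_self (hx r), one_mul, sub_self]

variable (q a A b x) in
/-- The factor of `rhsTerm` in front of the inner sum. -/
noncomputable def rhsCoeff (y : Fin n → ℂ) (k : Fin n → ℕ) : ℂ :=
  vandermonde q x k * yFactor q x y k *
    (∏ r, ∏ s, qPoch q (q * (x r / x s)) (k r))⁻¹ *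
    (∏ r, (1 - a * x r * q ^ (k r + size k)) / (1 - a * x r)) *
    (∏ r, (qPoch q (a * x r) (size k) * qPoch q (b * q * x r / A) (k r)) /
      (qPoch q (a * q * x r * y r) (size k) * qPoch q (b * q * x r) (k r))) *
    (qPoch q (a / b) (size k) / qPoch q (a * A / b) (size k)) *
    A ^ size k * powerq q k

variable (q a A b x) in
/-- The factor independent of `k` that relates the part of the right-hand side that contains
`β j` to `stringTerm` with the parameters `e = b q^{|j| + 1}` and `c = b q / A`. -/
noncomputable def stringConst (β : (Fin n → ℕ) → ℂ) (j N : Fin n → ℕ) : ℂ :=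
  vandermonde q x j * powerq q j * β j * yFactor q x (fun r => q ^ N r) j *
    (∏ r, (1 - b * x r * q ^ (j r + size j)) / (1 - b * x r)) *
    (∏ r, ((1 - a * x r) * qPoch q (b * q * x r) (N r + size j))⁻¹) *
    (qPoch q A (size j) / qPoch q (a * A / b) (size N)) *
    ((b * q / A) ^ (size N - size j))⁻¹

/-- The summands of the double sum on the right-hand side are multiples of those of the `₆φ₅` sum,
by a factor independent of `k`. -/
theorem rhsCoeff_mul_innerTerm (hq0 : q ≠ 0) (hq1 : ‖q‖ < 1)
    (D : DenomsNonzero q a A b x (fun r => q ^ N r) (Set.Iic N)) (β : (Fin n → ℕ) → ℂ)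
    (hjk : j ≤ k) (hkN : k ≤ N) :
    rhsCoeff q a A b x (fun r => q ^ N r) k * innerTerm q a A b x β k j =
      stringConst q a A b x β j N *
        stringTerm q a (b * q ^ (size j + 1)) (b * q / A) x j N k := by
  have hinj := D.injective hq0
  have hJK := size_mono hjk
  have hKL := size_mono hkN
  have hA := D.A_ne
  have hb := D.b_ne
  have hc : b * q / A ≠ 0 := div_ne_zero (mul_ne_zero hb hq0) hA
  have h1 := vandermonde_mul_yFactor (N := N) hq0 D.x_ne D.x_distinct hjk
    (yFactor_ne_zero D.x_ne hkN hinj)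
    (prod_ne_zero_iff.2 fun r _ => prod_ne_zero_iff.2 fun s _ => D.x_quot k hkN r s)
  have h2 := qPoch_div_qPoch_reflect (A := A) (Nat.add_sub_of_le hJK).symm hq0 D.a_ne hb hA
    (D.b_div_a k hkN j hjk)
  have h3 : ∀ r, (1 - a * x r * q ^ (k r + size k)) / (1 - a * x r) *
      ((qPoch q (a * x r) (size k) * qPoch q (b * q * x r / A) (k r)) /
        (qPoch q (a * q * x r * q ^ N r) (size k) * qPoch q (b * q * x r) (k r))) *
      (((1 - b * x r * q ^ (j r + size j)) * qPoch q (a * x r * q ^ size k) (j r)) /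
      ((1 - b * x r) * qPoch q (b * q * x r / A) (j r) *
        qPoch q (b * x r * q ^ (k r + 1)) (size j))) =
      (1 - b * x r * q ^ (j r + size j)) / (1 - b * x r) *
      ((1 - a * x r) * qPoch q (b * q * x r) (N r + size j))⁻¹ *
      ((1 - a * x r * q ^ (k r + size k)) * qPoch q (a * x r) (size k + j r) /
      qPoch q (a * x r * q ^ (N r + 1)) (size k)) *
      ((∏ i ∈ Ico (j r) (k r), (1 - b * q / A * (x r * q ^ i))) *
      ∏ i ∈ Ico (k r) (N r), (1 - b * q ^ (size j + 1) * (x r * q ^ i))) := by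
    intro r
    have h4 := qPoch_quotient_eq (c := b * q / A) (hjk r) (hkN r)
      (qPoch_ne_zero_of_qPochInf hq1 (D.bx_inf r) (N r + size j)) (D.bxA j (hjk.trans hkN) r) rfl
    rw [qPoch_add q (a * x r), show a * q * x r * q ^ N r = a * x r * q ^ (N r + 1) by ring]
    calc _ = (1 - b * x r * q ^ (j r + size j)) / (1 - b * x r) * (1 - a * x r)⁻¹ *
        ((1 - a * x r * q ^ (k r + size k)) * (qPoch q (a * x r) (size k) *
          qPoch q (a * x r * q ^ size k) (j r)) / qPoch q (a * x r * q ^ (N r + 1)) (size k)) *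
        (qPoch q (b * q * x r / A) (k r) / (qPoch q (b * q * x r) (k r) *
        (qPoch q (b * q * x r / A) (j r) * qPoch q (b * x r * q ^ (k r + 1)) (size j)))) := by
          simp only [div_eq_mul_inv, mul_inv]; ring
      _ = _ := by
          rw [h4]; simp only [div_eq_mul_inv, mul_inv]; ring
  have h5 : (qPoch q (a * A / b) (size k))⁻¹ = (qPoch q (a * A / b) (size N))⁻¹ *
      ((∏ i ∈ Ico (size k) (size N), (b * q / A - a * q ^ (i + 1))) *
        ((b * q / A) ^ (size N - size k))⁻¹) := by
    have e1 : ∏ i ∈ Ico (size k) (size N), (b * q / A - a * q ^ (i + 1)) =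
        (b * q / A) ^ (size N - size k) *
          ∏ i ∈ Ico (size k) (size N), (1 - a * A / b * q ^ i) := by
      rw [← Nat.card_Ico, ← prod_const, ← prod_mul_distrib]
      refine prod_congr rfl fun i _ => ?_
      field_simp
      ring
    have e2 : qPoch q (a * A / b) (size N) = qPoch q (a * A / b) (size k) *
        ∏ i ∈ Ico (size k) (size N), (1 - a * A / b * q ^ i) :=
      (prod_range_mul_prod_Ico _ hKL).symm
    have e3 := qPoch_ne_zero_of_qPochInf hq1 D.aAb_inf (size N)
    have e4 := pow_ne_zero (size N - size k) hc
    rw [e2] at e3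
    have := left_ne_zero_of_mul e3
    have := right_ne_zero_of_mul e3
    rw [e1, e2]
    generalize b * q / A = c at *
    generalize ∏ i ∈ Ico (size k) (size N), (1 - a * A / b * q ^ i) = P at *
    field_simp
  have h6 : (b * q / A) ^ (size N - size j) =
      (b * q / A) ^ (size N - size k) * (b * q / A) ^ (size k - size j) := by
    rw [← pow_add]; congr 1; omega
  have h3' : (∏ r, (1 - a * x r * q ^ (k r + size k)) / (1 - a * x r)) *
      (∏ r, ((qPoch q (a * x r) (size k) * qPoch q (b * q * x r / A) (k r)) /
        (qPoch q (a * q * x r * q ^ N r) (size k) * qPoch q (b * q * x r) (k r)))) *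
      (∏ r, (((1 - b * x r * q ^ (j r + size j)) * qPoch q (a * x r * q ^ size k) (j r)) /
      ((1 - b * x r) * qPoch q (b * q * x r / A) (j r) *
        qPoch q (b * x r * q ^ (k r + 1)) (size j)))) =
      (∏ r, (1 - b * x r * q ^ (j r + size j)) / (1 - b * x r)) *
      (∏ r, ((1 - a * x r) * qPoch q (b * q * x r) (N r + size j))⁻¹) *
      (∏ r, ((1 - a * x r * q ^ (k r + size k)) * qPoch q (a * x r) (size k + j r) /
      qPoch q (a * x r * q ^ (N r + 1)) (size k))) *
      ∏ r, ((∏ i ∈ Ico (j r) (k r), (1 - b * q / A * (x r * q ^ i))) *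
      ∏ i ∈ Ico (k r) (N r), (1 - b * q ^ (size j + 1) * (x r * q ^ i))) := by
    rw [← prod_mul_distrib, ← prod_mul_distrib, prod_congr rfl fun r _ => h3 r, prod_mul_distrib,
      prod_mul_distrib, prod_mul_distrib]
  calc _ = (vandermonde q x k * yFactor q x (fun r => q ^ N r) k *
        (∏ r, ∏ s, qPoch q (q * (x r / x s)) (k r))⁻¹ * powerq q k *
        (∏ r, ∏ s, qPoch q (q ^ (-(k s : ℤ)) * (x r / x s)) (j r))) *
      ((∏ r, (1 - a * x r * q ^ (k r + size k)) / (1 - a * x r)) *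
      (∏ r, ((qPoch q (a * x r) (size k) * qPoch q (b * q * x r / A) (k r)) /
        (qPoch q (a * q * x r * q ^ N r) (size k) * qPoch q (b * q * x r) (k r)))) *
      (∏ r, (((1 - b * x r * q ^ (j r + size j)) * qPoch q (a * x r * q ^ size k) (j r)) /
      ((1 - b * x r) * qPoch q (b * q * x r / A) (j r) *
        qPoch q (b * x r * q ^ (k r + 1)) (size j))))) *
      (qPoch q (a * A / b) (size k))⁻¹ *
      (A ^ size k * (b * q / (a * A)) ^ size j *
        (qPoch q (a / b) (size k) / qPoch q (b * q ^ (1 - (size k : ℤ)) / a) (size j))) *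
      (qPoch q A (size j) * (vandermonde q x j * powerq q j * β j)) := by
        unfold rhsCoeff innerTerm
        ring
    _ = ((-1) ^ size k * q ^ (size k).choose 2 * (q ^ (size k * size j))⁻¹ * A ^ size k *
        (b * q / (a * A)) ^ size j *
        (qPoch q (a / b) (size k) / qPoch q (b * q ^ (1 - (size k : ℤ)) / a) (size j))) *
      (stringWeight q x j N k * yFactor q x (fun r => q ^ N r) j) *
      ((∏ r, (1 - b * x r * q ^ (j r + size j)) / (1 - b * x r)) *
      (∏ r, ((1 - a * x r) * qPoch q (b * q * x r) (N r + size j))⁻¹) *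
      (∏ r, ((1 - a * x r * q ^ (k r + size k)) * qPoch q (a * x r) (size k + j r) /
      qPoch q (a * x r * q ^ (N r + 1)) (size k))) *
      ∏ r, ((∏ i ∈ Ico (j r) (k r), (1 - b * q / A * (x r * q ^ i))) *
      ∏ i ∈ Ico (k r) (N r), (1 - b * q ^ (size j + 1) * (x r * q ^ i)))) *
      (qPoch q (a * A / b) (size k))⁻¹ *
      (qPoch q A (size j) * (vandermonde q x j * powerq q j * β j)) := by
        rw [h1, h3']
        ring
    _ = _ := by
        rw [h2, h5, stringConst, h6, mul_inv, stringTerm]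
        generalize b * q / A = c
        ring

/-- The value of the `₆φ₅` sum, multiplied by `stringConst`, is the summand on the left-hand side. -/
theorem stringConst_mul_eq (hq0 : q ≠ 0) (hq1 : ‖q‖ < 1)
    (D : DenomsNonzero q a A b x (fun r => q ^ N r) (Set.Iic N)) (β : (Fin n → ℕ) → ℂ)
    (hjN : j ≤ N) :
    stringConst q a A b x β j N * ((∏ r, qPoch q (a * x r) (N r + 1)) *
      ∏ i ∈ range (size N - size j), (b * q / A - b * q ^ (size j + 1) * q ^ i)) =
    prefactor q a A b x (fun r => q ^ N r) * lhsTerm q b x (fun r => q ^ N r) β j := by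
  have hJL := size_mono hjN
  have hA := D.A_ne
  have hc : b * q / A ≠ 0 := div_ne_zero (mul_ne_zero D.b_ne hq0) hA
  have hy : ∏ r, q ^ N r = q ^ size N := prod_pow_eq_pow_sum _ _ _
  have h1 : qPoch q A (size j) * (((b * q / A) ^ (size N - size j))⁻¹ *
      ∏ i ∈ range (size N - size j), (b * q / A - b * q ^ (size j + 1) * q ^ i)) =
      qPoch q A (size N) := by
    have : ∏ i ∈ range (size N - size j), (b * q / A - b * q ^ (size j + 1) * q ^ i) =
        (b * q / A) ^ (size N - size j) * qPoch q (A * q ^ size j) (size N - size j) := by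
      rw [pow_eq_prod_range (b * q / A), qPoch, ← prod_mul_distrib]
      refine prod_congr rfl fun i _ => ?_
      field_simp
      ring
    rw [this, inv_mul_cancel_left₀ (pow_ne_zero _ hc), ← qPoch_add, Nat.add_sub_of_le hJL]
  have hAy := D.Ay_inf
  have haA := D.aAb_inf
  rw [hy] at hAy
  have h2 : (qPochInf q A * qPochInf q (a * A * q ^ size N / b)) /
      (qPochInf q (a * A / b) * qPochInf q (A * q ^ size N)) =
      qPoch q A (size N) / qPoch q (a * A / b) (size N) := by
    have e : a * A * q ^ size N / b = a * A / b * q ^ size N := by ring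
    rw [qPochInf_eq hq1 (a * A / b) (size N)] at haA ⊢
    rw [qPochInf_eq hq1 A (size N), e]
    have := left_ne_zero_of_mul haA
    have := right_ne_zero_of_mul haA
    generalize qPochInf q (a * A / b * q ^ size N) = u at *
    generalize qPoch q (a * A / b) (size N) = v at *
    field_simp
  have h3 : ∀ r, (qPochInf q (b * q * x r * q ^ N r) * qPochInf q (a * q * x r)) /
        (qPochInf q (a * q * x r * q ^ N r) * qPochInf q (b * q * x r)) *
      ((1 - b * x r * q ^ (j r + size j)) /
        ((1 - b * x r) * qPoch q (b * q * x r * q ^ N r) (size j))) =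
      (1 - b * x r * q ^ (j r + size j)) / (1 - b * x r) *
      ((1 - a * x r) * qPoch q (b * q * x r) (N r + size j))⁻¹ *
      qPoch q (a * x r) (N r + 1) := by
    intro r
    have e1 := D.axy_inf r
    have e2 := D.bx_inf r
    have e3 := D.one_sub_ax r
    have e4 : qPoch q (a * x r) (N r + 1) = (1 - a * x r) * qPoch q (a * q * x r) (N r) := by
      rw [add_comm, qPoch_add]
      simp [qPoch, mul_right_comm]
    rw [e4, qPoch_add, qPochInf_eq hq1 (a * q * x r) (N r)]
    rw [qPochInf_eq hq1 (b * q * x r) (N r)] at e2 ⊢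
    have := left_ne_zero_of_mul e2
    have := right_ne_zero_of_mul e2
    generalize qPochInf q (a * q * x r * q ^ N r) = u at *
    generalize qPochInf q (b * q * x r * q ^ N r) = v at *
    generalize 1 - a * x r = w at *
    generalize 1 - b * x r = z at *
    simp only [div_eq_mul_inv, mul_inv]
    field_simp
  have h3' : (∏ r, (qPochInf q (b * q * x r * q ^ N r) * qPochInf q (a * q * x r)) /
        (qPochInf q (a * q * x r * q ^ N r) * qPochInf q (b * q * x r))) *
      (∏ r, ((1 - b * x r * q ^ (j r + size j)) /
        ((1 - b * x r) * qPoch q (b * q * x r * q ^ N r) (size j)))) =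
      (∏ r, (1 - b * x r * q ^ (j r + size j)) / (1 - b * x r)) *
      (∏ r, ((1 - a * x r) * qPoch q (b * q * x r) (N r + size j))⁻¹) *
      ∏ r, qPoch q (a * x r) (N r + 1) := by
    rw [← prod_mul_distrib, prod_congr rfl fun r _ => h3 r, prod_mul_distrib, prod_mul_distrib]
  unfold stringConst prefactor lhsTerm
  rw [hy, h2, ← h1]
  generalize b * q / A = c
  linear_combination (-(qPoch q A (size j) * ((c ^ (size N - size j))⁻¹ *
      ∏ i ∈ range (size N - size j), (c - b * q ^ (size j + 1) * q ^ i)) /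
      qPoch q (a * A / b) (size N) * vandermonde q x j * powerq q j * β j *
      yFactor q x (fun r => q ^ N r) j)) * h3'

/-- The transformation formula in the terminating case `y_r = q^{N_r}`. -/
theorem prefactor_mul_tsum_eq_of_terminating (hq0 : q ≠ 0) (hq1 : ‖q‖ < 1)
    (D : DenomsNonzero q a A b x (fun r => q ^ N r) (Set.Iic N)) (β : (Fin n → ℕ) → ℂ) :
    (∀ j, ¬ j ≤ N → lhsTerm q b x (fun r => q ^ N r) β j = 0) ∧
      (∀ k, ¬ k ≤ N → rhsTerm q a A b x (fun r => q ^ N r) β k = 0) ∧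
      prefactor q a A b x (fun r => q ^ N r) *
          ∑' j, lhsTerm q b x (fun r => q ^ N r) β j =
        ∑' k, rhsTerm q a A b x (fun r => q ^ N r) β k := by
  have h1 : ∀ j, ¬ j ≤ N → lhsTerm q b x (fun r => q ^ N r) β j = 0 := fun j hj => by
    simp only [lhsTerm, yFactor_eq_zero D.x_ne hj, mul_zero, zero_mul]
  have h2 : ∀ k, ¬ k ≤ N → rhsTerm q a A b x (fun r => q ^ N r) β k = 0 := fun k hk => by
    simp only [rhsTerm, yFactor_eq_zero D.x_ne hk, mul_zero, zero_mul]
  refine ⟨h1, h2, ?_⟩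
  have haq : ∀ r i, 1 - a * x r * q ^ (N r + 1) * q ^ i ≠ 0 := by
    intro r i
    have := qPoch_ne_zero_iff.1 (qPoch_ne_zero_of_qPochInf hq1 (D.axy_inf r) (i + 1)) i (by omega)
    convert this using 2
    ring
  rw [tsum_eq_sum (s := Iic N) (fun j hj => h1 j (by simpa using hj)),
    tsum_eq_sum (s := Iic N) (fun k hk => h2 k (by simpa using hk)), mul_sum]
  have h3 : ∀ k ∈ Iic N, rhsTerm q a A b x (fun r => q ^ N r) β k =
      ∑ j ∈ Iic k, stringConst q a A b x β j N *
        stringTerm q a (b * q ^ (size j + 1)) (b * q / A) x j N k := by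
    intro k hk
    rw [sum_congr rfl fun j hj => (rhsCoeff_mul_innerTerm hq0 hq1 D β (mem_Iic.1 hj)
      (mem_Iic.1 hk)).symm, ← mul_sum]
    rfl
  rw [sum_congr rfl h3, sum_comm' (t' := Iic N) (s' := fun j => Icc j N)
    (fun k j => by
      simp only [mem_Iic, mem_Icc]
      exact ⟨fun h => ⟨⟨h.2, h.1⟩, h.2.trans h.1⟩, fun h => ⟨h.1.2, h.1.1⟩⟩)]
  refine sum_congr rfl fun j hj => ?_
  rw [← mul_sum, sum_stringTerm hq0 (mem_Iic.1 hj) D.x_ne (D.injective hq0) haq,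
    stringConst_mul_eq hq0 hq1 D β (mem_Iic.1 hj)]

end

/-! ### The identity theorem on a polydisc -/

theorem differentiable_qPochInf {q : ℂ} (hq1 : ‖q‖ < 1) : Differentiable ℂ (qPochInf q) := by
  intro u₀
  have hd : DifferentiableOn ℂ (fun u => ∏' i : ℕ, (1 + -(u * q ^ i)))
      (Metric.ball 0 (‖u₀‖ + 1)) := by
    have hprod := Summable.hasProdLocallyUniformlyOn_nat_one_add
      (f := fun (i : ℕ) (u : ℂ) => -(u * q ^ i)) (K := Metric.ball 0 (‖u₀‖ + 1)) Metric.isOpen_ball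
      ((summable_geometric_of_lt_one (norm_nonneg q) hq1).mul_left (‖u₀‖ + 1))
      (.of_forall fun i u hu => by
        rw [norm_neg, norm_mul, norm_pow]
        gcongr
        exact (mem_ball_zero_iff.1 hu).le) (fun i => by fun_prop)
    exact hprod.differentiableOn (.of_forall fun _ => by
      simpa [Finset.prod_fn] using DifferentiableOn.finsetProd (fun _ _ => by fun_prop))
      Metric.isOpen_ball
  have := hd.differentiableAt (Metric.isOpen_ball.mem_nhds
    (mem_ball_zero_iff.2 (lt_add_one ‖u₀‖)))
  simp only [← sub_eq_add_neg] at this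
  exact this

theorem analyticAt_prefactor {n : ℕ} {q a A b : ℂ} (hq1 : ‖q‖ < 1) {x y : Fin n → ℂ}
    {I : Set (Fin n → ℕ)} (D : DenomsNonzero q a A b x y I) :
    AnalyticAt ℂ (prefactor q a A b x) y := by
  have h : ∀ g : (Fin n → ℂ) → ℂ, AnalyticAt ℂ g y → AnalyticAt ℂ (fun y => qPochInf q (g y)) y :=
    fun g hg => ((differentiable_qPochInf hq1).analyticAt (g y)).comp hg
  have hy : ∀ r, AnalyticAt ℂ (fun y : Fin n → ℂ => y r) y := fun r =>
    (ContinuousLinearMap.proj (R := ℂ) (φ := fun _ : Fin n => ℂ) r).analyticAt y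
  have hprod : AnalyticAt ℂ (fun y : Fin n → ℂ => ∏ s, y s) y :=
    Finset.analyticAt_fun_prod _ fun s _ => hy s
  unfold prefactor
  refine AnalyticAt.fun_mul ?_ (Finset.analyticAt_fun_prod _ fun r _ => ?_)
  · refine AnalyticAt.fun_div ?_ ?_ (mul_ne_zero D.aAb_inf D.Ay_inf)
    · exact analyticAt_const.fun_mul
        (h _ ((analyticAt_const.fun_mul hprod).fun_div analyticAt_const D.b_ne))
    · exact analyticAt_const.fun_mul (h _ (analyticAt_const.fun_mul hprod))
  · refine AnalyticAt.fun_div ?_ ?_ (mul_ne_zero (D.axy_inf r) (D.bx_inf r))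
    · exact (h _ (analyticAt_const.fun_mul (hy r))).fun_mul analyticAt_const
    · exact (h _ (analyticAt_const.fun_mul (hy r))).fun_mul analyticAt_const

open Filter Topology in
/-- An identity theorem: a holomorphic function on a polydisc vanishes if it does at all points whose
coordinates lie in a set `T` that accumulates at `0`. The coordinates are released from `T` one by
one. -/
theorem eq_zero_on_polydisc {n : ℕ} {ρ : Fin n → ℝ} {f : (Fin n → ℂ) → ℂ} {T : Set ℂ}
    (hT : ∃ᶠ z in 𝓝[≠] (0 : ℂ), z ∈ T) (hf : ∀ y ∈ polydisc ρ, DifferentiableAt ℂ f y)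
    (h0 : ∀ y ∈ polydisc ρ, (∀ r, y r ∈ T) → f y = 0) : ∀ y ∈ polydisc ρ, f y = 0 := by
  suffices h : ∀ s : Finset (Fin n), ∀ y ∈ polydisc ρ, (∀ r ∉ s, y r ∈ T) → f y = 0 from
    fun y hy => h univ y hy fun r hr => absurd (mem_univ r) hr
  intro s
  induction s using Finset.induction_on with
  | empty => exact fun y hy h => h0 y hy fun r => h r (notMem_empty r)
  | insert r s _ ih =>
    intro y hy h
    have hmem : ∀ t ∈ Metric.ball (0 : ℂ) (ρ r), Function.update y r t ∈ polydisc ρ := by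
      intro t ht i
      by_cases hi : i = r
      · subst hi
        simpa using ht
      · simpa [hi] using hy i
    have hd : DifferentiableOn ℂ (fun t => f (Function.update y r t)) (Metric.ball 0 (ρ r)) :=
      fun t ht => ((hf _ (hmem t ht)).comp t
        (hasDerivAt_update y r t).differentiableAt).differentiableWithinAt
    have hρ : 0 < ρ r := (norm_nonneg _).trans_lt (hy r)
    have hzero := (hd.analyticOnNhd Metric.isOpen_ball).eqOn_zero_of_preconnected_of_frequently_eq_zero
      (convex_ball 0 (ρ r)).isPreconnected (Metric.mem_ball_self hρ) (by
        refine (hT.and_eventually (mem_nhdsWithin_of_mem_nhds (Metric.ball_mem_nhds 0 hρ))).mono ?_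
        rintro t ⟨htT, ht⟩
        refine ih _ (hmem t ht) fun i hi => ?_
        by_cases hir : i = r
        · subst hir
          simpa using htT
        · simpa [hir] using h i (by simp [hir, hi]))
    simpa using hzero (mem_ball_zero_iff.2 (hy r))

open Filter Topology in
theorem frequently_mem_range_pow {q : ℂ} (hq0 : q ≠ 0) (hq1 : ‖q‖ < 1) :
    ∃ᶠ z in 𝓝[≠] (0 : ℂ), z ∈ Set.range fun N : ℕ => q ^ N := by
  have h : Tendsto (fun N : ℕ => q ^ N) atTop (𝓝[≠] 0) :=
    tendsto_nhdsWithin_iff.2 ⟨tendsto_pow_atTop_nhds_zero_of_norm_lt_one hq1,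
      .of_forall fun N => pow_ne_zero N hq0⟩
  exact h.frequently (Eventually.of_forall fun N => ⟨N, rfl⟩).frequently

theorem DenomsNonzero.mono {n : ℕ} {q a A b : ℂ} {x y : Fin n → ℂ} {I I' : Set (Fin n → ℕ)}
    (D : DenomsNonzero q a A b x y I') (h : I ⊆ I') : DenomsNonzero q a A b x y I :=
  { D with
    bxy := fun j hj => D.bxy j (h hj)
    x_quot := fun k hk => D.x_quot k (h hk)
    bxA := fun j hj => D.bxA j (h hj)
    b_div_a := fun k hk => D.b_div_a k (h hk) }

end AnSeries

theorem mainTheorem2 {n : ℕ} (q a A b : ℂ) (hq0 : q ≠ 0) (hq1 : ‖q‖ < 1)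
    (x : Fin n → ℂ) (β : (Fin n → ℕ) → ℂ) :
    -- the non-terminating case: analyticity and absolute convergence in a polydisc
    (∀ ρ : Fin n → ℝ, (∀ r, 0 < ρ r) →
      (∀ y ∈ AnSeries.polydisc ρ, AnSeries.DenomsNonzero q a A b x y Set.univ) →
      (∀ y ∈ AnSeries.polydisc ρ, Summable fun j => ‖AnSeries.lhsTerm q b x y β j‖) →
      (∀ y ∈ AnSeries.polydisc ρ, Summable fun k => ‖AnSeries.rhsTerm q a A b x y β k‖) →
      AnalyticOnNhd ℂ (fun y => ∑' j, AnSeries.lhsTerm q b x y β j) (AnSeries.polydisc ρ) →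
      AnalyticOnNhd ℂ (fun y => ∑' k, AnSeries.rhsTerm q a A b x y β k) (AnSeries.polydisc ρ) →
      ∀ y ∈ AnSeries.polydisc ρ,
        AnSeries.prefactor q a A b x y * ∑' j, AnSeries.lhsTerm q b x y β j =
          ∑' k, AnSeries.rhsTerm q a A b x y β k) ∧
    -- the terminating case `y_r = q^{N_r}`
    (∀ N : Fin n → ℕ,
      AnSeries.DenomsNonzero q a A b x (fun r => q ^ N r) (Set.Iic N) →
      (∀ j, ¬ j ≤ N → AnSeries.lhsTerm q b x (fun r => q ^ N r) β j = 0) ∧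
      (∀ k, ¬ k ≤ N → AnSeries.rhsTerm q a A b x (fun r => q ^ N r) β k = 0) ∧
      AnSeries.prefactor q a A b x (fun r => q ^ N r) *
          ∑' j, AnSeries.lhsTerm q b x (fun r => q ^ N r) β j =
        ∑' k, AnSeries.rhsTerm q a A b x (fun r => q ^ N r) β k) := by
  refine ⟨?_, fun N D => AnSeries.prefactor_mul_tsum_eq_of_terminating hq0 hq1 D β⟩
  intro ρ _ hD _ _ hL hR y hy
  refine sub_eq_zero.1 (AnSeries.eq_zero_on_polydisc
    (f := fun y => AnSeries.prefactor q a A b x y * ∑' j, AnSeries.lhsTerm q b x y β j -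
      ∑' k, AnSeries.rhsTerm q a A b x y β k)
    (AnSeries.frequently_mem_range_pow hq0 hq1) ?_ ?_ y hy)
  · exact fun y hy => (((AnSeries.analyticAt_prefactor hq1 (hD y hy)).fun_mul (hL y hy)).fun_sub
      (hR y hy)).differentiableAt
  · intro y hy hyT
    choose N hN using hyT
    obtain rfl : (fun r => q ^ N r) = y := funext hN
    exact sub_eq_zero.2 (AnSeries.prefactor_mul_tsum_eq_of_terminating hq0 hq1
      ((hD _ hy).mono (Set.subset_univ _)) β).2.2
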